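/- Let $\mathcal H_A,\mathcal H_B$ be complex Hilbert spaces (possibly infinite-dimensional) and $\mathcal H_{AB}=\mathcal H_A\otimes\mathcal H_B$ their Hilbert space tensor product. Let $H_A$, $H_B$ be densely defined symmetric operators on $\mathcal H_A$, $\mathcal H_B$ with domains $\mathcal D(A)$, $\mathcal D(B)$, let $H_\partial$ be a linear operator in $\mathcal H_{AB}$ with domain the algebraic tensor product $\mathcal D(A)\otimes\mathcal D(B)$, and suppose that $$H_{AB}=H_A\otimes 1+1\otimes H_B+H_\partial\quad\text{on }\mathcal D(A)\otimes\mathcal D(B)$$ is essentially self-adjoint; denote its self-adjoint closure again by $H_{AB}$. Let $\beta>0$ and suppose that $Z_{AB}=\operatorname{tr}e^{-\beta H_{AB}}<\infty$. Let $\rho_{AB}=e^{-\beta H_{AB}}/Z_{AB}$ be the Gibbs state, with reduced states $\rho_A=\operatorname{tr}_{\mathcal H_B}\rho_{AB}$ and $\rho_B=\operatorname{tr}_{\mathcal H_A}\rho_{AB}$. For a densely defined symmetric operator $T$ and a bounded operator $\rho$, say that $\operatorname{tr}(T\rho)$ exists if the range of $\rho$ lies in the domain of the closure $\overline T$ and $\overline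 T\rho$ is trace class; then $\operatorname{tr}(T\rho)$ denotes the trace of $\overline T\rho$. Assume that the traces $\operatorname{tr}((H_A\otimes 1)\rho_{AB})$, $\operatorname{tr}((1\otimes H_B)\rho_{AB})$, $\operatorname{tr}(H_\partial\rho_{AB})$ and $\operatorname{tr}(H_\partial(\rho_A\otimes\rho_B))$ exist. Then the von Neumann entropies $S(\rho)=-\operatorname{tr}(\rho\ln\rho)$ of $\rho_{AB},\rho_A,\rho_B$ are finite, the trace $\operatorname{tr}(H_\partial(\rho_A\otimes\rho_B-\rho_{AB}))$ exists and is real, and the mutual information $I(A:B)=S(\rho_A)+S(\rho_B)-S(\rho_{AB})$ satisfies $$I(A:B)\le\beta\,\operatorname{tr}\bigl(H_\partial(\rho_A\otimes\rho_B-\rho_{AB})\bigr).$$ -/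

import Mathlib

open scoped TensorProduct InnerProductSpace ENNReal

noncomputable section

namespace QuantumThermal

section SingleSpace

variable {E : Type*} [NormedAddCommGroup E] [InnerProductSpace ℂ E]

/-- An operator is trace class (equivalently, on a Hilbert space, nuclear) if it is an absolutely
convergent sum of rank-one operators: `T z = ∑ₙ ⟪yₙ, z⟫ xₙ` with `∑ₙ ‖xₙ‖ ‖yₙ‖ < ∞`. -/
def IsTraceClass (T : E →L[ℂ] E) : Prop :=
  ∃ x y : ℕ → E, Summable (fun n => ‖x n‖ * ‖y n‖) ∧
    ∀ z : E, HasSum (fun n => ⟪y n, z⟫_ℂ • x n) (T z)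

/-- A symmetric operator, on its domain. -/
def IsSymmetric (T : E →ₗ.[ℂ] E) : Prop :=
  ∀ x y : T.domain, ⟪T x, (y : E)⟫_ℂ = ⟪(x : E), T y⟫_ℂ

/-- The quadratic form of `T` is bounded below. -/
def IsBoundedBelow (T : E →ₗ.[ℂ] E) : Prop :=
  ∃ c : ℝ, ∀ x : T.domain, c * ‖(x : E)‖ ^ 2 ≤ (⟪(x : E), T x⟫_ℂ).re

/-- The infimum of the quadratic form over the unit sphere of the domain. -/
def bottom (T : E →ₗ.[ℂ] E) : ℝ :=
  sInf {r | ∃ x : T.domain, ‖(x : E)‖ = 1 ∧ r = (⟪(x : E), T x⟫_ℂ).re}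

open Classical in
/-- The resolvent `(T - z)⁻¹` as an everywhere defined bounded operator:
`R x = y` iff `y` lies in the domain of `T` and `T y = x + z y`.  (It is `0` if there is none.) -/
def resolventOp (T : E →ₗ.[ℂ] E) (z : ℂ) : E →L[ℂ] E :=
  if h : ∃ R : E →L[ℂ] E, ∀ x y : E, R x = y ↔ (y, x + z • y) ∈ T.graph then h.choose else 0

/-- `K = T ρ` as an everywhere defined bounded operator: the range of `ρ` lies in the domain of
`T`, and `T (ρ x) = K x` for all `x`. -/
def IsProduct (T : E →ₗ.[ℂ] E) (ρ K : E →L[ℂ] E) : Prop :=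
  ∀ x : E, (ρ x, K x) ∈ T.graph

/-- The trace `tr (T ρ)` exists: `T ρ` is everywhere defined and trace class. -/
def HasTrace (T : E →ₗ.[ℂ] E) (ρ : E →L[ℂ] E) : Prop :=
  ∃ K : E →L[ℂ] E, IsProduct T ρ K ∧ IsTraceClass K

open Classical in
/-- The product `T ρ` of an unbounded and a bounded operator, when it is everywhere defined and
bounded (and `0` otherwise). -/
def productOp (T : E →ₗ.[ℂ] E) (ρ : E →L[ℂ] E) : E →L[ℂ] E :=
  if h : ∃ K : E →L[ℂ] E, IsProduct T ρ K then h.choose else 0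

variable [CompleteSpace E]

/-- `T` is essentially self-adjoint: its closure is self-adjoint. -/
def IsEssentiallySelfAdjoint (T : E →ₗ.[ℂ] E) : Prop :=
  IsSelfAdjoint T.closure

variable (E) in
/-- The index set of a fixed orthonormal (Hilbert) basis. -/
def basisIndex : Set E := (exists_hilbertBasis ℂ E).choose

variable (E) in
/-- A fixed orthonormal (Hilbert) basis. -/
def basis : HilbertBasis (basisIndex E) ℂ E := (exists_hilbertBasis ℂ E).choose_spec.choose

/-- The trace of a trace class operator. -/
def trace (T : E →L[ℂ] E) : ℂ := ∑' i, ⟪basis E i, T (basis E i)⟫_ℂ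

/-- The trace of a positive operator, with values in `[0, ∞]`. -/
def posTrace (T : E →L[ℂ] E) : ℝ≥0∞ :=
  ∑' i, ENNReal.ofReal (⟪basis E i, T (basis E i)⟫_ℂ).re

/-- `e^{-β H}` for a self-adjoint operator `H` that is bounded below, and `β > 0`.  With
`m = bottom H`, the operator `R = (H - m + 1)⁻¹` satisfies `0 ≤ R ≤ 1`, and `e^{-β H} = f(R)` by
the functional calculus, where `f(r) = exp(-β x)` for `r = 1 / (x - m + 1)` with `x` real, and
`f(0) = 0`. -/
def expNeg (β : ℝ) (H : E →ₗ.[ℂ] E) : E →L[ℂ] E :=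
  cfc (fun r : ℝ => if r ≤ 0 then 0 else Real.exp (-β * (r⁻¹ + bottom H - 1)))
    (resolventOp H ((bottom H - 1 : ℝ) : ℂ))

open Classical in
/-- The partition function `tr e^{-β H} ∈ [0, ∞]` of a self-adjoint operator `H`, for `β > 0`.  If
`H` is not bounded below, then `e^{-β H}` is unbounded and the trace is infinite. -/
def partitionFunction (β : ℝ) (H : E →ₗ.[ℂ] E) : ℝ≥0∞ :=
  if IsBoundedBelow H then posTrace (expNeg β H) else ⊤

/-- The Gibbs state `e^{-β H} / tr e^{-β H}`. -/
def gibbsState (β : ℝ) (H : E →ₗ.[ℂ] E) : E →L[ℂ] E :=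
  (partitionFunction β H).toReal⁻¹ • expNeg β H

/-- The von Neumann entropy `S(ρ) = -tr (ρ ln ρ) ∈ [0, ∞]` of a density matrix; the operator
`-ρ ln ρ` is given by the functional calculus. -/
def entropy (ρ : E →L[ℂ] E) : ℝ≥0∞ := posTrace (cfc Real.negMulLog ρ)

end SingleSpace

section Bipartite

variable (EA EB : Type*) [NormedAddCommGroup EA] [InnerProductSpace ℂ EA]
  [NormedAddCommGroup EB] [InnerProductSpace ℂ EB]

/-- The Hilbert space tensor product: the completion of the algebraic one. -/
abbrev HilbertTensor : Type _ := UniformSpace.Completion (EA ⊗[ℂ] EB)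

variable {EA EB}

/-- The algebraic tensor product of two subspaces, embedded in the Hilbert tensor product. -/
def domainEmbedding (p : Submodule ℂ EA) (q : Submodule ℂ EB) :
    (p ⊗[ℂ] q) →ₗ[ℂ] HilbertTensor EA EB :=
  (UniformSpace.Completion.toComplₗᵢ (𝕜 := ℂ) (E := EA ⊗[ℂ] EB)).toLinearMap ∘ₗ
    TensorProduct.mapIncl p q

theorem domainEmbedding_injective (p : Submodule ℂ EA) (q : Submodule ℂ EB) :
    Function.Injective (domainEmbedding p q) := by
  have h : Function.Injective (TensorProduct.mapIncl p q) :=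
    TensorProduct.map_injective_of_flat_flat _ _ p.subtype_injective q.subtype_injective
  exact (UniformSpace.Completion.toComplₗᵢ (𝕜 := ℂ) (E := EA ⊗[ℂ] EB)).injective.comp h

/-- The subspace `p ⊗ q` of the Hilbert tensor product (algebraic tensor product). -/
def tensorDomain (p : Submodule ℂ EA) (q : Submodule ℂ EB) : Submodule ℂ (HilbertTensor EA EB) :=
  LinearMap.range (domainEmbedding p q)

/-- The tensor product `S ⊗ T` of two unbounded operators, with domain the algebraic tensor
product of the two domains. -/
def tensorPMap (S : EA →ₗ.[ℂ] EA) (T : EB →ₗ.[ℂ] EB) :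
    HilbertTensor EA EB →ₗ.[ℂ] HilbertTensor EA EB where
  domain := tensorDomain S.domain T.domain
  toFun := (UniformSpace.Completion.toComplₗᵢ (𝕜 := ℂ) (E := EA ⊗[ℂ] EB)).toLinearMap ∘ₗ
    TensorProduct.map S.toFun T.toFun ∘ₗ
    (LinearEquiv.ofInjective (domainEmbedding S.domain T.domain)
      (domainEmbedding_injective S.domain T.domain)).symm.toLinearMap

/-- `S ⊗ 1`, with domain the algebraic tensor product of the domain of `S` and `EB`. -/
def tensorOne (S : EA →ₗ.[ℂ] EA) : HilbertTensor EA EB →ₗ.[ℂ] HilbertTensor EA EB :=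
  tensorPMap S ((LinearMap.id : EB →ₗ[ℂ] EB).toPMap ⊤)

/-- `1 ⊗ T`, with domain the algebraic tensor product of `EA` and the domain of `T`. -/
def oneTensor (T : EB →ₗ.[ℂ] EB) : HilbertTensor EA EB →ₗ.[ℂ] HilbertTensor EA EB :=
  tensorPMap ((LinearMap.id : EA →ₗ[ℂ] EA).toPMap ⊤) T

/-- The tensor product of two bounded operators, on the Hilbert tensor product. -/
def tensorCLM (S : EA →L[ℂ] EA) (T : EB →L[ℂ] EB) :
    HilbertTensor EA EB →L[ℂ] HilbertTensor EA EB :=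
  (TensorProduct.mapL S T).completion

/-- `u ↦ u ⊗ v`. -/
def tmulRight (v : EB) : EA →L[ℂ] HilbertTensor EA EB :=
  UniformSpace.Completion.toComplL ∘L ((TensorProduct.mkL ℂ EA EB).flip v)

/-- `v ↦ u ⊗ v`. -/
def tmulLeft (u : EA) : EB →L[ℂ] HilbertTensor EA EB :=
  UniformSpace.Completion.toComplL ∘L (TensorProduct.mkL ℂ EA EB u)

variable [CompleteSpace EA] [CompleteSpace EB]

/-- The partial trace over the second factor: `⟪u, (tr_B T) u'⟫ = ∑ⱼ ⟪u ⊗ eⱼ, T (u' ⊗ eⱼ)⟫`.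
For trace class `T` the sum of operators converges in norm. -/
def traceOutRight (T : HilbertTensor EA EB →L[ℂ] HilbertTensor EA EB) : EA →L[ℂ] EA :=
  ∑' j, (tmulRight (basis EB j)).adjoint ∘L T ∘L tmulRight (basis EB j)

/-- The partial trace over the first factor. -/
def traceOutLeft (T : HilbertTensor EA EB →L[ℂ] HilbertTensor EA EB) : EB →L[ℂ] EB :=
  ∑' i, (tmulLeft (basis EA i)).adjoint ∘L T ∘L tmulLeft (basis EA i)

/-- The mutual information `I(A:B) = S(ρ_A) + S(ρ_B) - S(ρ_AB)` of a state with finite entropies,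
where `ρ_A` and `ρ_B` are the reduced states. -/
def mutualInformation (ρ : HilbertTensor EA EB →L[ℂ] HilbertTensor EA EB) : ℝ :=
  (entropy (traceOutRight ρ)).toReal + (entropy (traceOutLeft ρ)).toReal - (entropy ρ).toReal

end Bipartite

end QuantumThermal

end

/-! With ρ = ρ_AB and σ = ρ_A ⊗ ρ_B the claim is the Gibbs variational principle: ρ minimizes the
free energy, so S(σ) - S(ρ) ≤ β (tr(Hσ) - tr(Hρ)) (`gibbs_variational`). Entropy is additive on
products (`entropy_tensorCLM`), so the left side is I(A:B). The states σ and ρ have the same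
marginals, so the two local terms have equal expectations and cancel; only H_∂ survives on the
right.

The variational principle is Klein's inequality (`entropy_le_tsum`) in an eigenbasis φ_k of H. Such
a basis exists because e^{-βH} is trace class, hence compact, and the resolvent of H is a function
of it (`exists_hilbertBasis_energy`).

The analytic difficulty is the meaning of Hσ: nothing says that σ maps into the domain of H. The
proof needs only a trace class K with ⟪Tz, σx⟫ = ⟪z, Kx⟫ for z in the domain (`IsWeakProduct`). This
relation survives sums and closures of T, and against an eigenvector it gives ⟪φ_k, Kφ_k⟫ = ε_k
⟪φ_k, σφ_k⟫, which is all that the energy sum uses. For the local terms in σ such a K is a partial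
trace of the given one, tensored with the other marginal (`IsWeakProduct.tensorOne_traceOutRight`,
`IsWeakProduct.oneTensor_traceOutLeft`). Symmetry of H_∂, which is not assumed, comes from
`interaction_graph_symm`. -/

noncomputable section

namespace QuantumThermal

/-! ### Trace class operators and basis independence of the trace. -/

section Nuclear

variable {E : Type*} [NormedAddCommGroup E] [InnerProductSpace ℂ E]

/-- `T = ∑ᵢ ⟪yᵢ, ·⟫ xᵢ`, absolutely convergent, over an arbitrary index type. -/
def IsNuclearSum {ι : Type*} (x y : ι → E) (T : E →L[ℂ] E) : Prop :=
  Summable (fun i => ‖x i‖ * ‖y i‖) ∧ ∀ z : E, HasSum (fun i => ⟪y i, z⟫_ℂ • x i) (T z)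

/-- A summable family has countable support, which injects into ℕ; the vectors are extended by zero.
This frees later constructions to use product and sum index types. -/
theorem IsNuclearSum.isTraceClass {ι : Type*} {x y : ι → E} {T : E →L[ℂ] E}
    (h : IsNuclearSum x y T) : IsTraceClass T := by
  classical
  obtain ⟨hs, hT⟩ := h
  set s : Set ι := Function.support fun i => ‖x i‖ * ‖y i‖ with hs_def
  have hc : s.Countable := hs.countable_support
  obtain ⟨e, he⟩ := (Set.countable_iff_exists_injective).1 hc
  have hzero : ∀ i, i ∉ s → x i = 0 ∨ y i = 0 := by
    intro i hi
    simpa [hs_def, or_iff_not_imp_left] using hi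
  have hx : ∀ i : s, Function.extend e (fun i : s => x i) 0 (e i) = x i := fun i =>
    he.extend_apply _ _ i
  have hy : ∀ i : s, Function.extend e (fun i : s => y i) 0 (e i) = y i := fun i =>
    he.extend_apply _ _ i
  refine ⟨Function.extend e (fun i : s => x i) 0, Function.extend e (fun i : s => y i) 0, ?_, ?_⟩
  · rw [← he.summable_iff]
    · have : Summable fun i : s => ‖x i‖ * ‖y i‖ := hs.subtype s
      refine this.congr fun i => ?_
      simp [hx, hy]
    · intro n hn
      rw [Function.extend_apply' _ _ _ (by simpa using hn)]
      simp
  · intro z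
    rw [← he.hasSum_iff]
    · have h1 : HasSum (fun i : s => ⟪y i, z⟫_ℂ • x i) (T z) := by
        have := hT z
        rwa [← Subtype.val_injective (p := (· ∈ s)) |>.hasSum_iff] at this
        intro i hi
        rcases hzero i (by simpa using hi) with h | h <;> simp [h]
      convert h1 using 1
      funext i
      simp [hx, hy]
    · intro n hn
      rw [Function.extend_apply' _ _ _ (by simpa using hn)]
      simp

theorem IsTraceClass.isNuclearSum {T : E →L[ℂ] E} (h : IsTraceClass T) :
    ∃ x y : ℕ → E, IsNuclearSum x y T := h

theorem IsTraceClass.add {S T : E →L[ℂ] E} (hS : IsTraceClass S) (hT : IsTraceClass T) :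
    IsTraceClass (S + T) := by
  obtain ⟨x, y, h1, h2⟩ := hS
  obtain ⟨x', y', h1', h2'⟩ := hT
  refine IsNuclearSum.isTraceClass (x := Sum.elim x x') (y := Sum.elim y y') ⟨?_, fun z => ?_⟩
  · refine (HasSum.sum (f := fun i => ‖Sum.elim x x' i‖ * ‖Sum.elim y y' i‖)
      (a := ∑' n, ‖x n‖ * ‖y n‖) (b := ∑' n, ‖x' n‖ * ‖y' n‖) ?_ ?_).summable
    · exact h1.hasSum
    · exact h1'.hasSum
  · exact HasSum.sum (h2 z) (h2' z)

theorem IsTraceClass.neg {T : E →L[ℂ] E} (hT : IsTraceClass T) : IsTraceClass (-T) := by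
  obtain ⟨x, y, h1, h2⟩ := hT
  refine ⟨fun n => -x n, y, by simpa using h1, fun z => ?_⟩
  simpa using (h2 z).neg

theorem IsTraceClass.sub {S T : E →L[ℂ] E} (hS : IsTraceClass S) (hT : IsTraceClass T) :
    IsTraceClass (S - T) := by
  rw [sub_eq_add_neg]
  exact hS.add hT.neg

theorem IsNuclearSum.summable_rankOne [CompleteSpace E] {ι : Type*} {x y : ι → E}
    (hs : Summable (fun i => ‖x i‖ * ‖y i‖)) :
    Summable fun i => InnerProductSpace.rankOne ℂ (x i) (y i) :=
  Summable.of_norm (by simpa using hs)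

/-- The norms ‖xᵢ‖‖yᵢ‖ of the rank-one terms are summable, so pointwise convergence improves to
operator norm convergence. -/
theorem IsNuclearSum.hasSum_rankOne [CompleteSpace E] {ι : Type*} {x y : ι → E} {T : E →L[ℂ] E}
    (h : IsNuclearSum x y T) :
    HasSum (fun i => InnerProductSpace.rankOne ℂ (x i) (y i)) T := by
  have hs := IsNuclearSum.summable_rankOne h.1
  convert hs.hasSum using 1
  ext z
  have h1 := (hs.hasSum.mapL (ContinuousLinearMap.apply ℂ E z))
  exact (h.2 z).unique (by simpa using h1)

theorem isNuclearSum_of_hasSum_rankOne {ι : Type*} {x y : ι → E} {T : E →L[ℂ] E}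
    (hs : Summable (fun i => ‖x i‖ * ‖y i‖))
    (h : HasSum (fun i => InnerProductSpace.rankOne ℂ (x i) (y i)) T) : IsNuclearSum x y T :=
  ⟨hs, fun z => by simpa using h.mapL (ContinuousLinearMap.apply ℂ E z)⟩

theorem isCompactOperator_rankOne (x y : E) :
    IsCompactOperator (InnerProductSpace.rankOne ℂ x y) := by
  rw [InnerProductSpace.rankOne_def']
  exact (isCompactOperator_of_locallyCompactSpace_rng
    (ContinuousLinearMap.toSpanSingleton ℂ x)).comp_clm (innerSL ℂ y)

theorem IsTraceClass.isCompactOperator [CompleteSpace E] {T : E →L[ℂ] E} (h : IsTraceClass T) :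
    IsCompactOperator T := by
  obtain ⟨x, y, h⟩ := h.isNuclearSum
  have h1 := h.hasSum_rankOne
  refine isCompactOperator_of_tendsto h1 (Filter.Eventually.of_forall fun s => ?_)
  have : ∑ i ∈ s, InnerProductSpace.rankOne ℂ (x i) (y i) ∈
      compactOperator (RingHom.id ℂ) E E :=
    Submodule.sum_mem _ fun i _ => isCompactOperator_rankOne (x i) (y i)
  exact this

theorem hasSum_norm_inner_sq {ι : Type*} (b : HilbertBasis ι ℂ E) (x : E) :
    HasSum (fun i => ‖⟪b i, x⟫_ℂ‖ ^ 2) (‖x‖ ^ 2) := by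
  have h := Complex.reCLM.hasSum (b.hasSum_inner_mul_inner x x)
  rw [show Complex.reCLM ⟪x, x⟫_ℂ = ‖x‖ ^ 2 from inner_self_eq_norm_sq (𝕜 := ℂ) x] at h
  refine h.congr_fun fun i => ?_
  rw [← inner_conj_symm x (b i), ← Complex.normSq_eq_conj_mul_self]
  rw [Complex.normSq_eq_norm_sq]
  exact (Complex.ofReal_re _).symm

/-- Cauchy–Schwarz in k, then comparison with the sum over i. It justifies each interchange of sums
for traces and partial traces. -/
theorem summable_mul_of_hasSum_sq {ι κ : Type*} {X Y : ι → ℝ} {F G : ι → κ → ℝ}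
    (hX : ∀ i, 0 ≤ X i) (hY : ∀ i, 0 ≤ Y i) (hXY : Summable fun i => X i * Y i)
    (hF : ∀ i k, 0 ≤ F i k) (hG : ∀ i k, 0 ≤ G i k)
    (hFX : ∀ i, HasSum (fun k => F i k ^ 2) (X i ^ 2))
    (hGY : ∀ i, HasSum (fun k => G i k ^ 2) (Y i ^ 2)) :
    Summable fun p : ι × κ => F p.1 p.2 * G p.1 p.2 := by
  have key : ∀ i, ∃ C, 0 ≤ C ∧ C ≤ X i * Y i ∧ HasSum (fun k => F i k * G i k) C := fun i =>
    Real.inner_le_Lp_mul_Lq_hasSum_of_nonneg Real.HolderConjugate.two_two (hX i) (hY i)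
      (hF i) (hG i) (by simpa using hFX i) (by simpa using hGY i)
  choose C hC0 hC1 hC2 using key
  rw [summable_prod_of_nonneg (fun p => mul_nonneg (hF _ _) (hG _ _))]
  refine ⟨fun i => (hC2 i).summable, ?_⟩
  simp only [(hC2 _).tsum_eq]
  exact Summable.of_nonneg_of_le hC0 hC1 hXY

/-- Summing over the basis first is Parseval's identity. The value does not mention the basis, and
the diagonal sum does not mention the nuclear representation, so each is independent of its choice.
-/
theorem IsNuclearSum.hasSum_inner_apply {ι κ : Type*} {x y : ι → E} {T : E →L[ℂ] E}
    (h : IsNuclearSum x y T) (b : HilbertBasis κ ℂ E) :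
    HasSum (fun k => ⟪b k, T (b k)⟫_ℂ) (∑' i, ⟪y i, x i⟫_ℂ) := by
  have hs : Summable fun p : ι × κ => ⟪y p.1, b p.2⟫_ℂ * ⟪b p.2, x p.1⟫_ℂ := by
    refine Summable.of_norm ?_
    simp only [norm_mul]
    refine summable_mul_of_hasSum_sq (X := fun i => ‖y i‖) (Y := fun i => ‖x i‖)
      (F := fun i k => ‖⟪y i, b k⟫_ℂ‖) (G := fun i k => ‖⟪b k, x i⟫_ℂ‖)
      (fun _ => norm_nonneg _) (fun _ => norm_nonneg _) (by simpa [mul_comm] using h.1)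
      (fun _ _ => norm_nonneg _) (fun _ _ => norm_nonneg _) (fun i => ?_)
      (fun i => hasSum_norm_inner_sq b (x i))
    simpa only [norm_inner_symm] using hasSum_norm_inner_sq b (y i)
  have h1 := hs.hasSum.prod_fiberwise fun i => b.hasSum_inner_mul_inner (y i) (x i)
  rw [h1.tsum_eq]
  have h2 := (Equiv.prodComm κ ι).hasSum_iff.2 hs.hasSum
  refine h2.prod_fiberwise fun k => ?_
  have := (h.2 (b k)).mapL (innerSL ℂ (b k))
  simpa [inner_smul_right] using this

theorem tsum_ofReal_norm_inner_sq {ι : Type*} (b : HilbertBasis ι ℂ E) (x : E) :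
    ∑' i, ENNReal.ofReal (‖⟪b i, x⟫_ℂ‖ ^ 2) = ENNReal.ofReal (‖x‖ ^ 2) := by
  have h := hasSum_norm_inner_sq b x
  rw [← ENNReal.ofReal_tsum_of_nonneg (fun _ => by positivity) h.summable, h.tsum_eq]

theorem re_inner_nonneg {T : E →L[ℂ] E} (hT : 0 ≤ T) (x : E) : 0 ≤ (⟪x, T x⟫_ℂ).re := by
  rw [ContinuousLinearMap.nonneg_iff_isPositive] at hT
  exact hT.re_inner_nonneg_right x

theorem im_inner_eq_zero {T : E →L[ℂ] E} (hT : 0 ≤ T) (x : E) : (⟪x, T x⟫_ℂ).im = 0 := by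
  rw [ContinuousLinearMap.nonneg_iff_isPositive] at hT
  exact (Complex.nonneg_iff.1 (hT.inner_nonneg_right x)).2.symm

theorem nonneg_of_re_im_inner {T : E →L[ℂ] E} (hre : ∀ x, 0 ≤ (⟪x, T x⟫_ℂ).re)
    (him : ∀ x, (⟪x, T x⟫_ℂ).im = 0) : 0 ≤ T := by
  rw [ContinuousLinearMap.nonneg_iff_isPositive, ContinuousLinearMap.isPositive_iff_complex]
  intro x
  have e : ⟪T x, x⟫_ℂ = ((⟪x, T x⟫_ℂ).re : ℂ) := by
    rw [← inner_conj_symm]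
    exact Complex.ext (by rw [Complex.conj_re, Complex.ofReal_re])
      (by rw [Complex.conj_im, Complex.ofReal_im, him, neg_zero])
  rw [e]
  exact ⟨by simp, by simpa using hre x⟩

theorem eq_zero_of_inner_hilbertBasis {ι : Type*} (b : HilbertBasis ι ℂ E) {x : E}
    (h : ∀ i, ⟪b i, x⟫_ℂ = 0) : x = 0 := by
  have := hasSum_norm_inner_sq b x
  simp only [h, norm_zero, ne_eq, OfNat.ofNat_ne_zero, not_false_eq_true, zero_pow] at this
  simpa using this.unique hasSum_zero

variable [CompleteSpace E]

theorem IsTraceClass.hasSum_trace {κ : Type*} {T : E →L[ℂ] E}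
    (h : IsTraceClass T) (b : HilbertBasis κ ℂ E) :
    HasSum (fun k => ⟪b k, T (b k)⟫_ℂ) (trace T) := by
  obtain ⟨x, y, h⟩ := h.isNuclearSum
  rw [trace, (h.hasSum_inner_apply (basis E)).tsum_eq]
  exact h.hasSum_inner_apply b

theorem IsNuclearSum.trace_eq {ι : Type*} {x y : ι → E} {T : E →L[ℂ] E}
    (h : IsNuclearSum x y T) : trace T = ∑' i, ⟪y i, x i⟫_ℂ :=
  (h.isTraceClass.hasSum_trace (basis E)).unique (h.hasSum_inner_apply (basis E))

theorem trace_add {S T : E →L[ℂ] E} (hS : IsTraceClass S) (hT : IsTraceClass T) :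
    trace (S + T) = trace S + trace T := by
  refine ((hS.add hT).hasSum_trace (basis E)).unique ?_
  simpa [inner_add_right] using (hS.hasSum_trace (basis E)).add (hT.hasSum_trace (basis E))

theorem trace_sub {S T : E →L[ℂ] E} (hS : IsTraceClass S) (hT : IsTraceClass T) :
    trace (S - T) = trace S - trace T := by
  refine ((hS.sub hT).hasSum_trace (basis E)).unique ?_
  simpa [inner_sub_right] using (hS.hasSum_trace (basis E)).sub (hT.hasSum_trace (basis E))

theorem exists_mul_self_eq_of_nonneg {T : E →L[ℂ] E} (hT : 0 ≤ T) :
    ∃ S : E →L[ℂ] E, (∀ x y, ⟪S x, y⟫_ℂ = ⟪x, S y⟫_ℂ) ∧ ∀ x, T x = S (S x) := by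
  refine ⟨CFC.sqrt T, ?_, ?_⟩
  · have h : 0 ≤ CFC.sqrt T := CFC.sqrt_nonneg T
    rw [ContinuousLinearMap.nonneg_iff_isPositive] at h
    exact h.inner_left_eq_inner_right
  · intro x
    conv_lhs => rw [← CFC.sqrt_mul_sqrt_self T hT]
    rfl

/-- The trace of a positive operator may be computed in any Hilbert basis. -/
theorem posTrace_eq_tsum {κ : Type*} {T : E →L[ℂ] E} (hT : 0 ≤ T) (b : HilbertBasis κ ℂ E) :
    posTrace T = ∑' k, ENNReal.ofReal (⟪b k, T (b k)⟫_ℂ).re := by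
  obtain ⟨S, hS, hTS⟩ := exists_mul_self_eq_of_nonneg hT
  have h1 : ∀ x, (⟪x, T x⟫_ℂ).re = ‖S x‖ ^ 2 := fun x => by
    rw [hTS, ← hS]
    exact inner_self_eq_norm_sq (𝕜 := ℂ) _
  simp only [posTrace, h1]
  -- Parseval, Tonelli for the nonnegative matrix |⟪b_k, S e_i⟫|², symmetry of S, and Parseval
  -- again.
  calc ∑' i, ENNReal.ofReal (‖S (basis E i)‖ ^ 2)
      = ∑' i, ∑' k, ENNReal.ofReal (‖⟪b k, S (basis E i)⟫_ℂ‖ ^ 2) := by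
        simp only [tsum_ofReal_norm_inner_sq]
    _ = ∑' k, ∑' i, ENNReal.ofReal (‖⟪b k, S (basis E i)⟫_ℂ‖ ^ 2) := ENNReal.tsum_comm
    _ = ∑' k, ∑' i, ENNReal.ofReal (‖⟪basis E i, S (b k)⟫_ℂ‖ ^ 2) := by
        simp only [← hS, norm_inner_symm]
    _ = ∑' k, ENNReal.ofReal (‖S (b k)‖ ^ 2) := by
        simp only [tsum_ofReal_norm_inner_sq]

/-- With T = S² and S symmetric, expanding Sz in the basis gives T = ∑ ⟪S eᵢ, ·⟫ S eᵢ, and ∑ ‖S eᵢ‖²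
is the trace. -/
theorem isTraceClass_of_posTrace_lt_top {T : E →L[ℂ] E} (hT : 0 ≤ T) (h : posTrace T < ⊤) :
    IsTraceClass T := by
  obtain ⟨S, hS, hTS⟩ := exists_mul_self_eq_of_nonneg hT
  have h1 : ∀ x, (⟪x, T x⟫_ℂ).re = ‖S x‖ ^ 2 := fun x => by
    rw [hTS, ← hS]
    exact inner_self_eq_norm_sq (𝕜 := ℂ) _
  refine IsNuclearSum.isTraceClass (x := fun i => S (basis E i)) (y := fun i => S (basis E i))
    ⟨?_, fun z => ?_⟩
  · simp only [posTrace, h1] at h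
    have := ENNReal.summable_toReal h.ne
    refine this.congr fun i => ?_
    rw [ENNReal.toReal_ofReal (by positivity), sq]
  · have := ((basis E).hasSum_repr (S z)).mapL S
    simpa [HilbertBasis.repr_apply_apply, hS, hTS] using this

theorem trace_eq_posTrace {T : E →L[ℂ] E} (hT : 0 ≤ T) (h : IsTraceClass T) :
    posTrace T < ⊤ ∧ trace T = ((posTrace T).toReal : ℂ) := by
  have h0 := h.hasSum_trace (basis E)
  have h1 : HasSum (fun i => (⟪basis E i, T (basis E i)⟫_ℂ).re) (trace T).re :=
    Complex.hasSum_re h0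
  have h2 : posTrace T = ENNReal.ofReal (trace T).re := by
    rw [posTrace, ← ENNReal.ofReal_tsum_of_nonneg (fun i => re_inner_nonneg hT _) h1.summable,
      h1.tsum_eq]
  refine ⟨h2 ▸ ENNReal.ofReal_lt_top, ?_⟩
  have h3 : (trace T).im = 0 := by
    refine (Complex.hasSum_im h0).unique ?_
    simp [im_inner_eq_zero hT]
  rw [h2, ENNReal.toReal_ofReal (h1.nonneg fun i => re_inner_nonneg hT _)]
  exact Complex.ext (by simp) (by simp [h3])

/-- A unit vector extends to a Hilbert basis, so its quadratic form value is a single term of the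
trace. -/
theorem le_one_of_posTrace_le_one {T : E →L[ℂ] E} (hT : 0 ≤ T) (h : posTrace T ≤ 1) : T ≤ 1 := by
  have hunit : ∀ x : E, ‖x‖ = 1 → (⟪x, T x⟫_ℂ).re ≤ 1 := by
    intro x hx
    have ho : Orthonormal ℂ ((↑) : ({x} : Set E) → E) := by
      refine ⟨fun i => by rw [i.2, hx], fun i j hij => (hij (Subsingleton.elim i j)).elim⟩
    obtain ⟨w, b, hw, hb⟩ := ho.exists_hilbertBasis_extension
    have hxw : x ∈ w := hw rfl
    rw [posTrace_eq_tsum hT b] at h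
    have := (ENNReal.le_tsum (f := fun k => ENNReal.ofReal (⟪b k, T (b k)⟫_ℂ).re)
      ⟨x, hxw⟩).trans h
    simpa [hb] using this
  rw [ContinuousLinearMap.le_def, ContinuousLinearMap.isPositive_def']
  refine ⟨(IsSelfAdjoint.one _).sub
    (((ContinuousLinearMap.nonneg_iff_isPositive T).1 hT).isSelfAdjoint), fun x => ?_⟩
  rw [ContinuousLinearMap.reApplyInnerSelf_apply, ← inner_conj_symm, RCLike.conj_re]
  simp only [sub_apply, one_apply_eq_self, inner_sub_right,
    map_sub, inner_self_eq_norm_sq]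
  by_cases hx : x = 0
  · simp [hx]
  have hx' : ‖x‖ ≠ 0 := by simpa using hx
  have := hunit (((‖x‖⁻¹ : ℝ) : ℂ) • x) (by simp [norm_smul, hx'])
  rw [map_smul, inner_smul_left, inner_smul_right, Complex.conj_ofReal, ← mul_assoc,
    ← Complex.ofReal_mul, Complex.re_ofReal_mul] at this
  have h3 : (⟪x, T x⟫_ℂ).re ≤ ‖x‖ ^ 2 := by
    have h4 := mul_le_mul_of_nonneg_left this (sq_nonneg ‖x‖)
    field_simp at h4
    simpa using h4
  simpa using h3

end Nuclear

/-! ### Product bases and bounded operators on the Hilbert tensor product. -/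

section Tensor

variable {EA EB : Type*} [NormedAddCommGroup EA] [InnerProductSpace ℂ EA]
  [NormedAddCommGroup EB] [InnerProductSpace ℂ EB]

/-- The elementary tensor `u ⊗ v` in the Hilbert tensor product. -/
def pureTensor (u : EA) (v : EB) : HilbertTensor EA EB := ((u ⊗ₜ[ℂ] v : EA ⊗[ℂ] EB) : _)

theorem tmulRight_apply (u : EA) (v : EB) : tmulRight v u = pureTensor u v := rfl

theorem tmulLeft_apply (u : EA) (v : EB) : tmulLeft u v = pureTensor u v := rfl

theorem inner_pureTensor (u u' : EA) (v v' : EB) :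
    ⟪pureTensor u v, pureTensor u' v'⟫_ℂ = ⟪u, u'⟫_ℂ * ⟪v, v'⟫_ℂ := by
  simp [pureTensor, UniformSpace.Completion.inner_coe]

theorem norm_pureTensor (u : EA) (v : EB) : ‖pureTensor u v‖ = ‖u‖ * ‖v‖ := by
  simp [pureTensor]

theorem pureTensor_smul_smul (c d : ℂ) (u : EA) (v : EB) :
    pureTensor (c • u) (d • v) = (c * d) • pureTensor u v := by
  rw [← tmulRight_apply, map_smul, tmulRight_apply, ← tmulLeft_apply, map_smul, smul_smul,
    tmulLeft_apply]

theorem tensorCLM_pureTensor (S : EA →L[ℂ] EA) (T : EB →L[ℂ] EB) (u : EA) (v : EB) :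
    tensorCLM S T (pureTensor u v) = pureTensor (S u) (T v) := by
  simp [tensorCLM, pureTensor]

/-- The elementary tensors span a dense subspace. -/
theorem eq_zero_of_inner_pureTensor {x : HilbertTensor EA EB}
    (h : ∀ u v, ⟪pureTensor u v, x⟫_ℂ = 0) : x = 0 := by
  have h1 : ∀ z : HilbertTensor EA EB, ⟪z, x⟫_ℂ = 0 := by
    intro z
    induction z using UniformSpace.Completion.induction_on with
    | hp => exact isClosed_eq (by fun_prop) (by fun_prop)
    | ih t =>
      induction t with
      | zero => rw [UniformSpace.Completion.coe_zero, inner_zero_left]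
      | tmul u v => exact h u v
      | add s t hs ht => rw [UniformSpace.Completion.coe_add, inner_add_left, hs, ht, add_zero]
  exact inner_self_eq_zero.1 (h1 x)

theorem clm_ext_pureTensor {F : Type*} [NormedAddCommGroup F] [NormedSpace ℂ F]
    {S T : HilbertTensor EA EB →L[ℂ] F} (h : ∀ u v, S (pureTensor u v) = T (pureTensor u v)) :
    S = T := by
  ext z
  induction z using UniformSpace.Completion.induction_on with
  | hp => exact isClosed_eq (by fun_prop) (by fun_prop)
  | ih t =>
    induction t with
    | zero => rw [UniformSpace.Completion.coe_zero, map_zero, map_zero]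
    | tmul u v => exact h u v
    | add s t hs ht => rw [UniformSpace.Completion.coe_add, map_add, map_add, hs, ht]

/-- With square roots P and Q of the factors, S ⊗ T = (P ⊗ Q)*(P ⊗ Q). -/
theorem tensorCLM_nonneg [CompleteSpace EA] [CompleteSpace EB] {S : EA →L[ℂ] EA}
    {T : EB →L[ℂ] EB} (hS : 0 ≤ S) (hT : 0 ≤ T) : 0 ≤ tensorCLM S T := by
  obtain ⟨P, hP, hSP⟩ := exists_mul_self_eq_of_nonneg hS
  obtain ⟨Q, hQ, hTQ⟩ := exists_mul_self_eq_of_nonneg hT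
  have h1 : (tensorCLM P Q).adjoint = tensorCLM P Q := by
    refine clm_ext_pureTensor fun u v => ?_
    rw [← sub_eq_zero]
    refine eq_zero_of_inner_pureTensor fun u' v' => ?_
    rw [inner_sub_right, ContinuousLinearMap.adjoint_inner_right]
    simp only [tensorCLM_pureTensor, inner_pureTensor, hP, hQ, sub_self]
  have h2 : tensorCLM S T = (tensorCLM P Q).adjoint ∘L tensorCLM P Q := by
    refine clm_ext_pureTensor fun u v => ?_
    rw [h1, ContinuousLinearMap.comp_apply]
    simp only [tensorCLM_pureTensor, hSP, hTQ]
  rw [h2, ContinuousLinearMap.nonneg_iff_isPositive]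
  exact ContinuousLinearMap.isPositive_adjoint_comp_self _

/-- The product of two Hilbert bases. -/
theorem exists_tensor_hilbertBasis [CompleteSpace EA] [CompleteSpace EB] {ι κ : Type*}
    (a : HilbertBasis ι ℂ EA) (b : HilbertBasis κ ℂ EB) :
    ∃ c : HilbertBasis (ι × κ) ℂ (HilbertTensor EA EB),
      ∀ p, c p = pureTensor (a p.1) (b p.2) := by
  classical
  have ho : Orthonormal ℂ fun p : ι × κ => pureTensor (a p.1) (b p.2) := by
    rw [orthonormal_iff_ite]
    rintro ⟨i, j⟩ ⟨i', j'⟩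
    rw [inner_pureTensor, orthonormal_iff_ite.1 a.orthonormal, orthonormal_iff_ite.1 b.orthonormal]
    by_cases h1 : i = i' <;> by_cases h2 : j = j' <;> simp [h1, h2]
  refine ⟨HilbertBasis.mkOfOrthogonalEqBot ho ?_, fun p => by
    rw [HilbertBasis.coe_mkOfOrthogonalEqBot]⟩
  rw [Submodule.eq_bot_iff]
  intro x hx
  have hx' : ∀ i j, ⟪pureTensor (a i) (b j), x⟫_ℂ = 0 := fun i j =>
    hx _ (Submodule.subset_span ⟨(i, j), rfl⟩)
  -- Completeness one factor at a time: the adjoint of u ↦ u ⊗ b_j sends x to a vector orthogonal to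
  -- the whole basis a.
  have h1 : ∀ u j, ⟪pureTensor u (b j), x⟫_ℂ = 0 := by
    intro u j
    have : (tmulRight (b j) : EA →L[ℂ] HilbertTensor EA EB).adjoint x = 0 :=
      eq_zero_of_inner_hilbertBasis a fun i => by
        rw [ContinuousLinearMap.adjoint_inner_right, tmulRight_apply, hx']
    rw [← tmulRight_apply, ← ContinuousLinearMap.adjoint_inner_right, this, inner_zero_right]
  refine eq_zero_of_inner_pureTensor fun u v => ?_
  have : (tmulLeft u : EB →L[ℂ] HilbertTensor EA EB).adjoint x = 0 :=
    eq_zero_of_inner_hilbertBasis b fun j => by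
      rw [ContinuousLinearMap.adjoint_inner_right, tmulLeft_apply, h1]
  rw [← tmulLeft_apply, ← ContinuousLinearMap.adjoint_inner_right, this, inner_zero_right]

/-- Parseval for the product basis, grouped by the second index: the maps V_j : u ↦ u ⊗ e_j satisfy
∑ V_j V_j* = 1. Both partial traces are treated through such a resolution. -/
theorem hasSum_inner_adjoint_tmulRight [CompleteSpace EA] [CompleteSpace EB]
    (x y : HilbertTensor EA EB) :
    HasSum (fun j => ⟪(tmulRight (basis EB j) : EA →L[ℂ] HilbertTensor EA EB).adjoint x,
      (tmulRight (basis EB j) : EA →L[ℂ] HilbertTensor EA EB).adjoint y⟫_ℂ) ⟪x, y⟫_ℂ := by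
  obtain ⟨c, hc⟩ := exists_tensor_hilbertBasis (basis EA) (basis EB)
  have h1 := (Equiv.prodComm _ _).hasSum_iff.2 (c.hasSum_inner_mul_inner x y)
  refine h1.prod_fiberwise fun j => ?_
  have := (basis EA).hasSum_inner_mul_inner
    ((tmulRight (basis EB j) : EA →L[ℂ] HilbertTensor EA EB).adjoint x)
    ((tmulRight (basis EB j) : EA →L[ℂ] HilbertTensor EA EB).adjoint y)
  simpa [ContinuousLinearMap.adjoint_inner_right, ContinuousLinearMap.adjoint_inner_left, hc,
    tmulRight_apply] using this

theorem hasSum_inner_adjoint_tmulLeft [CompleteSpace EA] [CompleteSpace EB]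
    (x y : HilbertTensor EA EB) :
    HasSum (fun i => ⟪(tmulLeft (basis EA i) : EB →L[ℂ] HilbertTensor EA EB).adjoint x,
      (tmulLeft (basis EA i) : EB →L[ℂ] HilbertTensor EA EB).adjoint y⟫_ℂ) ⟪x, y⟫_ℂ := by
  obtain ⟨c, hc⟩ := exists_tensor_hilbertBasis (basis EA) (basis EB)
  refine (c.hasSum_inner_mul_inner x y).prod_fiberwise fun i => ?_
  have := (basis EB).hasSum_inner_mul_inner
    ((tmulLeft (basis EA i) : EB →L[ℂ] HilbertTensor EA EB).adjoint x)
    ((tmulLeft (basis EA i) : EB →L[ℂ] HilbertTensor EA EB).adjoint y)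
  simpa [ContinuousLinearMap.adjoint_inner_right, ContinuousLinearMap.adjoint_inner_left, hc,
    tmulLeft_apply] using this

theorem IsTraceClass.tensorCLM [CompleteSpace EA] [CompleteSpace EB] {S : EA →L[ℂ] EA}
    {T : EB →L[ℂ] EB} (hS : IsTraceClass S) (hT : IsTraceClass T) :
    IsTraceClass (tensorCLM S T) := by
  obtain ⟨x, y, hS⟩ := hS.isNuclearSum
  obtain ⟨x', y', hT⟩ := hT.isNuclearSum
  set X : ℕ × ℕ → HilbertTensor EA EB := fun p => pureTensor (x p.1) (x' p.2) with hX
  set Y : ℕ × ℕ → HilbertTensor EA EB := fun p => pureTensor (y p.1) (y' p.2) with hY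
  have hs : Summable fun p => ‖X p‖ * ‖Y p‖ := by
    refine (hS.1.mul_of_nonneg hT.1 (fun _ => by positivity) (fun _ => by positivity)).congr
      fun p => ?_
    simp only [hX, hY, norm_pureTensor]
    ring
  have hW := (IsNuclearSum.summable_rankOne hs).hasSum
  refine IsNuclearSum.isTraceClass (isNuclearSum_of_hasSum_rankOne hs ?_)
  convert hW using 1
  -- The double sum converges in norm, so on u ⊗ v it can be evaluated iteratively: first over the
  -- representation of T, then over that of S.
  refine clm_ext_pureTensor fun u v => ?_
  have h1 := hW.mapL (ContinuousLinearMap.apply ℂ _ (pureTensor u v))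
  refine (HasSum.prod_fiberwise h1
    (g := fun n => pureTensor (⟪y n, u⟫_ℂ • x n) (T v)) fun n => ?_).unique ?_ |>.symm
  · have := (hT.2 v).mapL (tmulLeft (⟪y n, u⟫_ℂ • x n))
    simp only [map_smul, tmulLeft_apply] at this
    convert this using 2 with m
    have e := pureTensor_smul_smul ⟪y n, u⟫_ℂ 1 (x n) (x' m)
    rw [one_smul, mul_one] at e
    simp [hX, hY, inner_pureTensor, e, smul_smul, mul_comm]
  · have := (hS.2 u).mapL (tmulRight (T v))
    rw [tensorCLM_pureTensor]
    simpa only [tmulRight_apply] using this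

theorem trace_tensorCLM [CompleteSpace EA] [CompleteSpace EB] {S : EA →L[ℂ] EA}
    {T : EB →L[ℂ] EB} (hS : IsTraceClass S) (hT : IsTraceClass T) :
    trace (tensorCLM S T) = trace S * trace T := by
  obtain ⟨c, hc⟩ := exists_tensor_hilbertBasis (basis EA) (basis EB)
  have h1 := (hS.tensorCLM hT).hasSum_trace c
  simp only [hc, tensorCLM_pureTensor, inner_pureTensor] at h1
  have h2 := h1.prod_fiberwise
    (g := fun i => ⟪basis EA i, S (basis EA i)⟫_ℂ * trace T)
    fun i => (hT.hasSum_trace (basis EB)).mul_left ⟪basis EA i, S (basis EA i)⟫_ℂ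
  exact h2.unique ((hS.hasSum_trace (basis EA)).mul_right _)

end Tensor

/-! ### Partial traces from a resolution of the identity. -/

section PartialTrace

variable {F G : Type*} [NormedAddCommGroup F] [InnerProductSpace ℂ F] [CompleteSpace F]
  [NormedAddCommGroup G] [InnerProductSpace ℂ G] [CompleteSpace G]

/-- A partial trace with respect to a resolution `∑ⱼ Vⱼ Vⱼ* = 1` preserves the trace class and the
trace. -/
theorem IsTraceClass.partialTrace {κ : Type*} {V : κ → F →L[ℂ] G}
    (hV : ∀ x y, HasSum (fun j => ⟪(V j).adjoint x, (V j).adjoint y⟫_ℂ) ⟪x, y⟫_ℂ)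
    {T : G →L[ℂ] G} (hT : IsTraceClass T) :
    Summable (fun j => (V j).adjoint ∘L T ∘L V j) ∧
      IsTraceClass (∑' j, (V j).adjoint ∘L T ∘L V j) ∧
      trace (∑' j, (V j).adjoint ∘L T ∘L V j) = trace T := by
  obtain ⟨x, y, hT⟩ := hT.isNuclearSum
  have hsq : ∀ z, HasSum (fun j => ‖(V j).adjoint z‖ ^ 2) (‖z‖ ^ 2) := by
    intro z
    have := Complex.hasSum_re (hV z z)
    simpa [inner_self_eq_norm_sq_to_K, ← Complex.ofReal_pow] using this
  have hs : Summable fun p : ℕ × κ => ‖(V p.2).adjoint (x p.1)‖ * ‖(V p.2).adjoint (y p.1)‖ :=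
    summable_mul_of_hasSum_sq (X := fun i => ‖x i‖) (Y := fun i => ‖y i‖)
      (F := fun i j => ‖(V j).adjoint (x i)‖) (G := fun i j => ‖(V j).adjoint (y i)‖)
      (fun _ => norm_nonneg _) (fun _ => norm_nonneg _) hT.1
      (fun _ _ => norm_nonneg _) (fun _ _ => norm_nonneg _) (fun i => hsq _) (fun i => hsq _)
  have hW := (IsNuclearSum.summable_rankOne hs).hasSum
  have hnuc := isNuclearSum_of_hasSum_rankOne hs hW
  have hsum : HasSum (fun j => (V j).adjoint ∘L T ∘L V j)
      (∑' p : ℕ × κ, InnerProductSpace.rankOne ℂ ((V p.2).adjoint (x p.1))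
        ((V p.2).adjoint (y p.1))) := by
    -- For fixed j the inner sum over n is the compression V_j* T V_j, term by term.
    refine ((Equiv.prodComm κ ℕ).hasSum_iff.2 hW).prod_fiberwise fun j => ?_
    have h1 := (hT.hasSum_rankOne.mapL
      (ContinuousLinearMap.compL ℂ F G F (V j).adjoint ∘L
        (ContinuousLinearMap.compL ℂ F G G).flip (V j)))
    refine h1.congr_fun fun n => ?_
    ext z
    simp [ContinuousLinearMap.adjoint_inner_left]
  refine ⟨hsum.summable, hsum.tsum_eq ▸ hnuc.isTraceClass, ?_⟩
  rw [hsum.tsum_eq, hnuc.trace_eq, hT.trace_eq]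
  have hs2 : Summable fun p : ℕ × κ =>
      ⟪(V p.2).adjoint (y p.1), (V p.2).adjoint (x p.1)⟫_ℂ :=
    Summable.of_norm_bounded hs fun p => by
      rw [mul_comm]
      exact norm_inner_le_norm _ _
  exact ((hs2.hasSum.prod_fiberwise fun i => hV (y i) (x i)).tsum_eq).symm

theorem inner_partialTrace {κ : Type*} {V : κ → F →L[ℂ] G} {T : G →L[ℂ] G}
    (h : Summable fun j => (V j).adjoint ∘L T ∘L V j) (u u' : F) :
    HasSum (fun j => ⟪V j u, T (V j u')⟫_ℂ) ⟪u, (∑' j, (V j).adjoint ∘L T ∘L V j) u'⟫_ℂ := by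
  have := h.hasSum.mapL (innerSL ℂ u ∘L ContinuousLinearMap.apply ℂ F u')
  simpa [ContinuousLinearMap.adjoint_inner_right] using this

theorem partialTrace_nonneg {κ : Type*} {V : κ → F →L[ℂ] G} {T : G →L[ℂ] G} (hT : 0 ≤ T)
    (h : Summable fun j => (V j).adjoint ∘L T ∘L V j) :
    0 ≤ ∑' j, (V j).adjoint ∘L T ∘L V j := by
  refine nonneg_of_re_im_inner (fun x => ?_) (fun x => ?_)
  · exact (Complex.hasSum_re (inner_partialTrace h x x)).nonneg fun j => re_inner_nonneg hT _
  · refine (Complex.hasSum_im (inner_partialTrace h x x)).unique ?_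
    simp [im_inner_eq_zero hT]

end PartialTrace

/-! ### Resolvents, functional calculus and the eigenbasis of the Hamiltonian. -/

section Spectral

universe u

variable {E : Type u} [NormedAddCommGroup E] [InnerProductSpace ℂ E]

theorem bottom_mul_le {H : E →ₗ.[ℂ] E} (hb : IsBoundedBelow H) (x : H.domain) :
    bottom H * ‖(x : E)‖ ^ 2 ≤ (⟪(x : E), H x⟫_ℂ).re := by
  obtain ⟨c, hc⟩ := hb
  by_cases hx : (x : E) = 0
  · simp [hx]
  have hx' : ‖(x : E)‖ ≠ 0 := by simpa using hx
  have hbdd : BddBelow {r | ∃ x : H.domain, ‖(x : E)‖ = 1 ∧ r = (⟪(x : E), H x⟫_ℂ).re} := by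
    refine ⟨c, ?_⟩
    rintro r ⟨y, hy, rfl⟩
    simpa [hy] using hc y
  have h1 : bottom H ≤ ‖(x : E)‖⁻¹ * ‖(x : E)‖⁻¹ * (⟪(x : E), H x⟫_ℂ).re := by
    refine csInf_le hbdd ⟨((‖(x : E)‖⁻¹ : ℝ) : ℂ) • x, ?_, ?_⟩
    · simp [norm_smul, hx']
    · rw [LinearPMap.map_smul, Submodule.coe_smul, inner_smul_left, inner_smul_right,
        Complex.conj_ofReal, ← mul_assoc, ← Complex.ofReal_mul, Complex.re_ofReal_mul]
  calc bottom H * ‖(x : E)‖ ^ 2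
      ≤ ‖(x : E)‖⁻¹ * ‖(x : E)‖⁻¹ * (⟪(x : E), H x⟫_ℂ).re * ‖(x : E)‖ ^ 2 := by gcongr
    _ = (⟪(x : E), H x⟫_ℂ).re := by field_simp

/-- Shifting to one below the bottom makes the form of H - z at least ‖x‖², the coercivity behind
the resolvent. -/
theorem norm_sq_fst_le_of_mem_graph {H : E →ₗ.[ℂ] E} (hb : IsBoundedBelow H) {p : E × E}
    (hp : p ∈ H.graph) :
    ‖p.1‖ ^ 2 ≤ (⟪p.1, p.2 - ((bottom H - 1 : ℝ) : ℂ) • p.1⟫_ℂ).re := by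
  obtain ⟨x, hx1, hx2⟩ := (LinearPMap.mem_graph_iff _).1 hp
  have h := bottom_mul_le hb x
  rw [hx1, hx2] at h
  have h1 : (⟪p.1, p.1⟫_ℂ).re = ‖p.1‖ ^ 2 := inner_self_eq_norm_sq (𝕜 := ℂ) _
  rw [inner_sub_right, inner_smul_right, Complex.sub_re, Complex.re_ofReal_mul, h1]
  linarith

theorem norm_fst_le_of_mem_graph {H : E →ₗ.[ℂ] E} (hb : IsBoundedBelow H) {p : E × E}
    (hp : p ∈ H.graph) : ‖p.1‖ ≤ ‖p.2 - ((bottom H - 1 : ℝ) : ℂ) • p.1‖ := by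
  have h1 := norm_sq_fst_le_of_mem_graph hb hp
  have h2 := h1.trans ((Complex.re_le_norm _).trans (norm_inner_le_norm _ _))
  by_cases h0 : ‖p.1‖ = 0
  · rw [h0]
    positivity
  · have : 0 < ‖p.1‖ := lt_of_le_of_ne (norm_nonneg _) (Ne.symm h0)
    rw [sq] at h2
    exact le_of_mul_le_mul_left h2 this

theorem mem_spectrum_of_apply_eq_smul {a : E →L[ℂ] E} {v : E} (hv : v ≠ 0) {l : ℝ}
    (h : a v = (l : ℂ) • v) : l ∈ spectrum ℝ a := by
  rw [spectrum.mem_iff]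
  rintro ⟨w, hw⟩
  have h1 : (algebraMap ℝ (E →L[ℂ] E) l - a) v = 0 := by
    rw [sub_apply, h, Algebra.algebraMap_eq_smul_one]
    simp
  apply hv
  have h2 : ((w⁻¹ : (E →L[ℂ] E)ˣ) : E →L[ℂ] E) ((w : E →L[ℂ] E) v) = v := by
    rw [← mul_apply_eq_comp, Units.inv_mul]
    rfl
  rw [← h2, hw, h1, map_zero]

variable [CompleteSpace E]

/-- The functions satisfying the identity form a closed subalgebra containing constants and the
coordinate; Stone–Weierstrass, as an induction principle, gives all continuous ones. -/
theorem cfc_apply_of_apply_eq_smul {a : E →L[ℂ] E} (ha : IsSelfAdjoint a) {v : E} {l : ℝ}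
    (h : a v = (l : ℂ) • v) {f : ℝ → ℝ} (hf : ContinuousOn f (spectrum ℝ a)) :
    cfc f a v = (f l : ℂ) • v := by
  by_cases hv : v = 0
  · simp [hv]
  have hl := mem_spectrum_of_apply_eq_smul hv h
  rw [cfc_apply f a ha hf]
  suffices H : ∀ g : C(spectrum ℝ a, ℝ), cfcHom ha g v = (g ⟨l, hl⟩ : ℂ) • v from H _
  intro g
  have : CompactSpace (spectrum ℝ a) := by
    rw [← isCompact_iff_compactSpace]
    exact ContinuousFunctionalCalculus.isCompact_spectrum a
  induction g using ContinuousMap.induction_on_of_compact with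
  | const r =>
    have : cfcHom ha (ContinuousMap.const _ r) = algebraMap ℝ (E →L[ℂ] E) r :=
      AlgHomClass.commutes (cfcHom ha) r
    rw [this, Algebra.algebraMap_eq_smul_one]
    simp
  | id => rw [cfcHom_id ha, h]; rfl
  | star_id => rw [map_star, cfcHom_id ha, ha.star_eq, h]; rfl
  | add f g hf hg => rw [map_add, add_apply, hf, hg, ← add_smul]; simp
  | mul f g hf hg =>
    rw [map_mul, mul_apply_eq_comp, hg, map_smul, hf, smul_smul]
    simp [mul_comm]
  | frequently g hg =>
    have hcl : IsClosed {g : C(spectrum ℝ a, ℝ) | cfcHom ha g v = (g ⟨l, hl⟩ : ℂ) • v} := by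
      refine isClosed_eq ?_ ?_
      · exact (ContinuousLinearMap.apply ℂ E v).continuous.comp (cfcHom_continuous ha)
      · exact (Complex.continuous_ofReal.comp (continuous_eval_const _)).smul
          continuous_const
    exact hcl.closure_eq.subset (mem_closure_iff_frequently.2 hg)

/-- A compact positive operator has a Hilbert basis of eigenvectors. -/
theorem exists_hilbertBasis_eigenvectors {T : E →L[ℂ] E} (hT : 0 ≤ T)
    (hc : IsCompactOperator T) :
    ∃ (ι : Type u) (b : HilbertBasis ι ℂ E) (l : ι → ℝ), ∀ i, T (b i) = (l i : ℂ) • b i := by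
  have hpos := (ContinuousLinearMap.nonneg_iff_isPositive T).1 hT
  have hsymm : (T : E →ₗ[ℂ] E).IsSymmetric := hpos.isSymmetric
  have hclosed : ∀ l : ℂ, IsClosed (Module.End.eigenspace (T : E →ₗ[ℂ] E) l : Set E) := by
    intro l
    have : (Module.End.eigenspace (T : E →ₗ[ℂ] E) l : Set E) = {x | T x = l • x} := by
      ext x
      simp
    rw [this]
    exact isClosed_eq (by fun_prop) (by fun_prop)
  have : ∀ l : ℂ, CompleteSpace (Module.End.eigenspace (T : E →ₗ[ℂ] E) l) := fun l =>
    (hclosed l).completeSpace_coe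
  choose w b _ using fun l : ℂ =>
    exists_hilbertBasis ℂ (Module.End.eigenspace (T : E →ₗ[ℂ] E) l)
  have ho : Orthonormal ℂ fun p : Σ l : ℂ, w l => ((b p.1 p.2 : _) : E) :=
    hsymm.orthogonalFamily_eigenspaces.orthonormal_sigma_orthonormal fun l => (b l).orthonormal
  have hbot : (Submodule.span ℂ (Set.range fun p : Σ l : ℂ, w l => ((b p.1 p.2 : _) : E)))ᗮ
      = ⊥ := by
    rw [Submodule.eq_bot_iff]
    intro x hx
    have h1 : x ∈ (⨆ l, Module.End.eigenspace (T : E →ₗ[ℂ] E) l)ᗮ := by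
      rw [← Submodule.iInf_orthogonal, Submodule.mem_iInf]
      intro l
      rw [← Submodule.orthogonalProjectionOnto_eq_zero_iff]
      refine eq_zero_of_inner_hilbertBasis (b l) fun i => ?_
      rw [Submodule.inner_orthogonalProjectionOnto_eq_of_mem_left]
      exact hx _ (Submodule.subset_span ⟨⟨l, i⟩, rfl⟩)
    have h2 := ContinuousLinearMap.orthogonalComplement_iSup_eigenspaces_eq_bot hc hsymm
    rw [h2] at h1
    simpa using h1
  refine ⟨_, HilbertBasis.mkOfOrthogonalEqBot ho hbot,
    fun p => (⟪((b p.1 p.2 : _) : E), T (b p.1 p.2 : _)⟫_ℂ).re, fun p => ?_⟩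
  rw [HilbertBasis.coe_mkOfOrthogonalEqBot]
  have h1 : T (b p.1 p.2 : _) = p.1 • ((b p.1 p.2 : _) : E) :=
    Module.End.mem_eigenspace_iff.1 (b p.1 p.2).2
  have h2 : ⟪((b p.1 p.2 : _) : E), T (b p.1 p.2 : _)⟫_ℂ = p.1 := by
    -- The eigenvalue is the diagonal matrix element, which positivity makes real; hence the choice
    -- of its real part as witness.
    rw [h1, inner_smul_right, inner_self_eq_norm_sq_to_K, ho.1 p]
    simp
  have h3 : (((⟪((b p.1 p.2 : _) : E), T (b p.1 p.2 : _)⟫_ℂ).re : ℝ) : ℂ) = p.1 := by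
    refine Complex.ext (by rw [h2]; simp) ?_
    have h4 := im_inner_eq_zero hT ((b p.1 p.2 : _) : E)
    rw [h2] at h4
    rw [h4, Complex.ofReal_im]
  change T (b p.1 p.2 : _) = (((⟪((b p.1 p.2 : _) : E), T (b p.1 p.2 : _)⟫_ℂ).re : ℝ) : ℂ) • _
  rw [h3, h1]

/-- The graph of H is that of its adjoint, so membership is tested by pairing with the graph. One
direction yields symmetry, the other maximality. -/
theorem mem_graph_iff_of_isSelfAdjoint {H : E →ₗ.[ℂ] E} (hH : IsSelfAdjoint H) {p : E × E} :
    p ∈ H.graph ↔ ∀ q ∈ H.graph, ⟪q.2, p.1⟫_ℂ = ⟪q.1, p.2⟫_ℂ := by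
  have h := LinearPMap.adjoint_graph_eq_graph_adjoint hH.dense_domain
  rw [LinearPMap.isSelfAdjoint_def.1 hH] at h
  conv_lhs => rw [h]
  rw [Submodule.mem_adjoint_iff]
  simp only [Prod.forall, sub_eq_zero]

/-- The resolvent of a self-adjoint operator below the bottom of its quadratic form. -/
theorem exists_resolvent {H : E →ₗ.[ℂ] E} (hH : IsSelfAdjoint H) (hb : IsBoundedBelow H) :
    ∃ R : E →L[ℂ] E, ∀ x y : E, R x = y ↔
      (y, x + ((bottom H - 1 : ℝ) : ℂ) • y) ∈ H.graph := by
  set z : ℂ := ((bottom H - 1 : ℝ) : ℂ) with hz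
  have hG : IsClosed (H.graph : Set (E × E)) := hH.isClosed
  have : CompleteSpace H.graph := hG.completeSpace_coe
  -- H - z as a bounded map on the complete space `H.graph`. Coercivity makes it bounded below, so
  -- its range is closed.
  let f : H.graph →L[ℂ] E :=
    (ContinuousLinearMap.snd ℂ E E - z • ContinuousLinearMap.fst ℂ E E) ∘L H.graph.subtypeL
  have hf : ∀ p : H.graph, f p = (p : E × E).2 - z • (p : E × E).1 := fun p => rfl
  have hfst : ∀ p : H.graph, ‖(p : E × E).1‖ ≤ ‖f p‖ := fun p =>
    norm_fst_le_of_mem_graph hb p.2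
  have hbound : ∀ p : H.graph, ‖p‖ ≤ (1 + ‖z‖₊ : NNReal) * ‖f p‖ := by
    intro p
    have h2 : ‖(p : E × E).2‖ ≤ ‖f p‖ + ‖z‖ * ‖(p : E × E).1‖ := by
      have : (p : E × E).2 = f p + z • (p : E × E).1 := by rw [hf]; abel
      calc ‖(p : E × E).2‖ = ‖f p + z • (p : E × E).1‖ := by rw [← this]
        _ ≤ ‖f p‖ + ‖z • (p : E × E).1‖ := norm_add_le _ _
        _ = _ := by rw [norm_smul]
    have h3 : ‖z‖ * ‖(p : E × E).1‖ ≤ ‖z‖ * ‖f p‖ := by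
      gcongr
      exact hfst p
    have h4 : 0 ≤ ‖z‖ * ‖f p‖ := by positivity
    rw [Submodule.coe_norm, Prod.norm_def]
    push_cast
    refine max_le ?_ ?_
    · linarith [hfst p]
    · linarith
  have hanti := ContinuousLinearMap.antilipschitz_of_bound f hbound
  have hclosed : IsClosed (LinearMap.range f.toLinearMap : Set E) :=
    hanti.isClosed_range f.uniformContinuous
  have hrange : LinearMap.range f.toLinearMap = ⊤ := by
    rw [← hclosed.submodule_topologicalClosure_eq, Submodule.topologicalClosure_eq_top_iff,
      Submodule.eq_bot_iff]
    intro w hw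
    -- A vector orthogonal to the range lies in the domain with Hw = zw, and coercivity forces w =
    -- 0.
    have h1 : ∀ q ∈ H.graph, ⟪q.2, w⟫_ℂ = ⟪q.1, z • w⟫_ℂ := by
      intro q hq
      have h2 : ⟪q.2 - z • q.1, w⟫_ℂ = 0 := hw _ ⟨⟨q, hq⟩, rfl⟩
      rw [inner_sub_left, inner_smul_left, sub_eq_zero, hz, Complex.conj_ofReal] at h2
      rw [h2, inner_smul_right]
    have h2 : (w, z • w) ∈ H.graph := (mem_graph_iff_of_isSelfAdjoint hH).2 h1
    have h3 := norm_fst_le_of_mem_graph hb h2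
    rw [← hz, sub_self, norm_zero] at h3
    exact norm_le_zero_iff.1 h3
  let e := ContinuousLinearEquiv.ofBijective f (LinearMap.ker_eq_bot.2 hanti.injective) hrange
  have he : ∀ p, e p = f p := fun p => rfl
  refine ⟨ContinuousLinearMap.fst ℂ E E ∘L H.graph.subtypeL ∘L (e.symm : E →L[ℂ] H.graph),
    fun x y => ⟨?_, fun h => ?_⟩⟩
  · rintro rfl
    have h1 : f (e.symm x) = x := by rw [← he, e.apply_symm_apply]
    rw [hf] at h1
    have h2 : x + z • (e.symm x : E × E).1 = (e.symm x : E × E).2 := by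
      rw [← sub_eq_iff_eq_add.1 h1]
    change ((e.symm x : E × E).1, x + z • (e.symm x : E × E).1) ∈ H.graph
    rw [h2]
    exact (e.symm x).2
  · have h1 : e ⟨_, h⟩ = x := by
      rw [he, hf]
      simp
    rw [← h1]
    simp

theorem resolventOp_spec {H : E →ₗ.[ℂ] E} (hH : IsSelfAdjoint H) (hb : IsBoundedBelow H)
    (x y : E) : resolventOp H ((bottom H - 1 : ℝ) : ℂ) x = y ↔
      (y, x + ((bottom H - 1 : ℝ) : ℂ) • y) ∈ H.graph := by
  have h := exists_resolvent hH hb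
  rw [resolventOp, dif_pos h]
  exact h.choose_spec x y

theorem resolventOp_nonneg {H : E →ₗ.[ℂ] E} (hH : IsSelfAdjoint H) (hb : IsBoundedBelow H) :
    0 ≤ resolventOp H ((bottom H - 1 : ℝ) : ℂ) := by
  have h1 := fun x => (resolventOp_spec hH hb x _).1 rfl
  set R := resolventOp H ((bottom H - 1 : ℝ) : ℂ)
  have hsymm : ∀ x, ⟪x, R x⟫_ℂ = ⟪R x, x⟫_ℂ := by
    intro x
    have h2 := (mem_graph_iff_of_isSelfAdjoint hH).1 (h1 x) _ (h1 x)
    simp only [inner_add_left, inner_add_right, inner_smul_left, inner_smul_right,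
      Complex.conj_ofReal] at h2
    exact add_right_cancel h2
  refine nonneg_of_re_im_inner (fun x => ?_) (fun x => ?_)
  · have h2 := norm_sq_fst_le_of_mem_graph hb (h1 x)
    rw [add_sub_cancel_right, ← hsymm] at h2
    exact (sq_nonneg _).trans h2
  · have h2 := congrArg Complex.im (hsymm x)
    rw [← inner_conj_symm (R x) x, Complex.conj_im] at h2
    linarith

/-- At 0 the exponent tends to -∞, so the value 0 is the continuous extension. Without continuity on
the spectrum, `cfc` would take its default value 0. -/
theorem continuousOn_exp_inv {β : ℝ} (hβ : 0 < β) (m : ℝ) :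
    ContinuousOn (fun r : ℝ => if r ≤ 0 then 0 else Real.exp (-β * (r⁻¹ + m - 1)))
      (Set.Ici 0) := by
  intro r hr
  rcases (Set.mem_Ici.1 hr).eq_or_lt with rfl | hr
  · rw [← continuousWithinAt_Ioi_iff_Ici, ContinuousWithinAt, if_pos le_rfl]
    have h1 : Filter.Tendsto (fun r : ℝ => Real.exp (-β * (r⁻¹ + m - 1)))
        (nhdsWithin 0 (Set.Ioi 0)) (nhds 0) := by
      refine Real.tendsto_exp_atBot.comp ?_
      refine Filter.Tendsto.const_mul_atTop_of_neg (neg_lt_zero.2 hβ) ?_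
      simp only [add_sub_assoc]
      exact Filter.tendsto_atTop_add_const_right _ _ tendsto_inv_nhdsGT_zero
    refine h1.congr' ?_
    filter_upwards [self_mem_nhdsWithin] with x hx
    rw [if_neg (not_le.2 hx)]
  · refine ContinuousAt.continuousWithinAt ?_
    have h1 : ContinuousAt (fun r : ℝ => Real.exp (-β * (r⁻¹ + m - 1))) r := by
      have := hr.ne'
      fun_prop (disch := assumption)
    refine h1.congr ?_
    filter_upwards [lt_mem_nhds hr] with x hx
    rw [if_neg (not_le.2 hx)]

/-- This function inverts the one defining e^{-βH} from the resolvent; its continuity lets the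
resolvent be recovered from e^{-βH}. -/
theorem continuousWithinAt_inv_log_zero {β : ℝ} (hβ : 0 < β) (m : ℝ) :
    ContinuousWithinAt (fun q : ℝ => if q ≤ 0 then 0 else (-(Real.log q) / β - m + 1)⁻¹)
      (Set.Ici 0) 0 := by
  rw [← continuousWithinAt_Ioi_iff_Ici, ContinuousWithinAt, if_pos le_rfl]
  have h1 : Filter.Tendsto (fun q : ℝ => (-(Real.log q) / β - m + 1)⁻¹)
      (nhdsWithin 0 (Set.Ioi 0)) (nhds 0) := by
    refine tendsto_inv_atTop_zero.comp ?_
    simp only [sub_add]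
    simp only [sub_eq_add_neg]
    refine Filter.tendsto_atTop_add_const_right _ _ ?_
    refine Filter.Tendsto.atTop_div_const hβ ?_
    exact Filter.tendsto_neg_atBot_atTop.comp Real.tendsto_log_nhdsGT_zero
  refine h1.congr' ?_
  filter_upwards [self_mem_nhdsWithin] with x hx
  rw [if_neg (not_le.2 hx)]

theorem continuousAt_inv_log {β : ℝ} (m : ℝ) {q : ℝ} (hq : 0 < q)
    (h : -(Real.log q) / β - m + 1 ≠ 0) :
    ContinuousAt (fun q : ℝ => if q ≤ 0 then 0 else (-(Real.log q) / β - m + 1)⁻¹) q := by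
  have h1 : ContinuousAt (fun q : ℝ => (-(Real.log q) / β - m + 1)⁻¹) q := by
    have := hq.ne'
    fun_prop (disch := assumption)
  refine h1.congr ?_
  filter_upwards [lt_mem_nhds hq] with x hx
  rw [if_neg (not_le.2 hx)]

theorem expNeg_nonneg (β : ℝ) (H : E →ₗ.[ℂ] E) : 0 ≤ expNeg β H := by
  refine cfc_nonneg fun r _ => ?_
  split_ifs
  · exact le_rfl
  · positivity

theorem partitionFunction_eq_posTrace {β : ℝ} {H : E →ₗ.[ℂ] E}
    (hZ : partitionFunction β H < ⊤) :
    IsBoundedBelow H ∧ partitionFunction β H = posTrace (expNeg β H) := by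
  rw [partitionFunction] at hZ ⊢
  split_ifs at hZ ⊢ with hb
  · exact ⟨hb, rfl⟩
  · exact absurd hZ (lt_irrefl _)

/-- A self-adjoint operator with finite partition function has a Hilbert basis of eigenvectors. -/
theorem exists_hilbertBasis_energy {H : E →ₗ.[ℂ] E} (hH : IsSelfAdjoint H) {β : ℝ} (hβ : 0 < β)
    (hZ : partitionFunction β H < ⊤) :
    ∃ (ι : Type u) (φ : HilbertBasis ι ℂ E) (ε : ι → ℝ),
      (∀ k, (φ k, (ε k : ℂ) • φ k) ∈ H.graph) ∧
      ∀ k, expNeg β H (φ k) = (Real.exp (-β * ε k) : ℂ) • φ k := by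
  obtain ⟨hb, hZ'⟩ := partitionFunction_eq_posTrace hZ
  rw [hZ'] at hZ
  have hspec := resolventOp_spec hH hb
  have hR0 := resolventOp_nonneg hH hb
  have hT0 := expNeg_nonneg β H
  set T := expNeg β H with hT
  set m := bottom H
  set R := resolventOp H ((m - 1 : ℝ) : ℂ) with hR
  set f : ℝ → ℝ := fun r => if r ≤ 0 then 0 else Real.exp (-β * (r⁻¹ + m - 1)) with hf
  set g : ℝ → ℝ := fun q => if q ≤ 0 then 0 else (-(Real.log q) / β - m + 1)⁻¹ with hg
  have hTf : T = cfc f R := rfl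
  have hRsa : IsSelfAdjoint R := ((ContinuousLinearMap.nonneg_iff_isPositive R).1 hR0).isSelfAdjoint
  have hTsa : IsSelfAdjoint T := ((ContinuousLinearMap.nonneg_iff_isPositive T).1 hT0).isSelfAdjoint
  have hsp : ∀ r ∈ spectrum ℝ R, 0 ≤ r := fun r hr => spectrum_nonneg_of_nonneg hR0 hr
  have hfc : ContinuousOn f (spectrum ℝ R) := (continuousOn_exp_inv hβ m).mono hsp
  have hlog : ∀ r, 0 < r → -(Real.log (f r)) / β - m + 1 = r⁻¹ := by
    intro r hr
    simp only [hf, if_neg (not_le.2 hr), Real.log_exp]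
    field_simp
    ring
  have hfpos : ∀ r, 0 < r → 0 < f r := by
    intro r hr
    simp only [hf, if_neg (not_le.2 hr)]
    positivity
  have hf0 : f 0 = 0 := by simp [hf]
  have hgf : ∀ r ∈ spectrum ℝ R, g (f r) = r := by
    intro r hr
    rcases (hsp r hr).eq_or_lt with rfl | hr
    · simp [hf0, hg]
    · change (if f r ≤ 0 then 0 else (-(Real.log (f r)) / β - m + 1)⁻¹) = r
      rw [if_neg (not_le.2 (hfpos r hr)), hlog r hr, inv_inv]
  have hgc : ContinuousOn g (f '' spectrum ℝ R) := by
    rintro _ ⟨r, hr, rfl⟩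
    rcases (hsp r hr).eq_or_lt with rfl | hr
    · rw [hf0]
      refine (continuousWithinAt_inv_log_zero hβ m).mono ?_
      rintro _ ⟨s, hs, rfl⟩
      rcases (hsp s hs).eq_or_lt with rfl | hs
      · exact hf0.ge
      · exact (hfpos s hs).le
    · refine (continuousAt_inv_log m (hfpos r hr) ?_).continuousWithinAt
      rw [hlog r hr]
      positivity
  -- Since g ∘ f is the identity on the spectrum of R, eigenvectors of the compact operator T are
  -- eigenvectors of R.
  have hRg : R = cfc g T := by
    rw [hTf, ← cfc_comp g f R hRsa hgc hfc]
    conv_lhs => rw [← cfc_id ℝ R hRsa]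
    exact cfc_congr fun r hr => (hgf r hr).symm
  have hgc' : ContinuousOn g (spectrum ℝ T) := by
    rwa [hTf, cfc_map_spectrum f R hRsa hfc]
  obtain ⟨ι, φ, t, ht⟩ := exists_hilbertBasis_eigenvectors hT0
    (isTraceClass_of_posTrace_lt_top hT0 hZ).isCompactOperator
  have hφ : ∀ k, φ k ≠ 0 := fun k => φ.orthonormal.ne_zero k
  have hRφ : ∀ k, R (φ k) = (g (t k) : ℂ) • φ k := fun k => by
    conv_lhs => rw [hRg]
    exact cfc_apply_of_apply_eq_smul hTsa (ht k) hgc'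
  have hr0 : ∀ k, 0 < g (t k) := by
    intro k
    -- A resolvent is injective, so 0 is not an eigenvalue of R.
    refine lt_of_le_of_ne (hsp _ (mem_spectrum_of_apply_eq_smul (hφ k) (hRφ k))) ?_
    intro h0
    have h1 := hRφ k
    rw [← h0, Complex.ofReal_zero, zero_smul, hspec, smul_zero, add_zero] at h1
    exact hφ k (LinearPMap.graph_fst_eq_zero_snd H h1 rfl)
  -- The energy ε solves r = 1 / (ε - m + 1) for the resolvent eigenvalue r.
  refine ⟨ι, φ, fun k => (g (t k))⁻¹ + m - 1, fun k => ?_, fun k => ?_⟩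
  · have h1 := (hspec _ _).1 (hRφ k)
    have h2 := H.graph.smul_mem ((g (t k) : ℂ))⁻¹ h1
    have h3 : (g (t k) : ℂ) ≠ 0 := by exact_mod_cast (hr0 k).ne'
    convert h2 using 1
    refine Prod.ext ?_ ?_
    · simp only [Prod.smul_fst, smul_smul, inv_mul_cancel₀ h3, one_smul]
    · simp only [Prod.smul_snd, smul_add, smul_smul, ← add_smul]
      congr 1
      push_cast
      field_simp
      ring
  · rw [hTf, cfc_apply_of_apply_eq_smul hRsa (hRφ k) hfc]
    simp only [hf, if_neg (not_le.2 (hr0 k))]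

end Spectral

/-! ### Entropy, additivity and Klein's inequality. -/

section Entropy

universe u v

theorem re_inner_smul_basis {E ι : Type*} [NormedAddCommGroup E] [InnerProductSpace ℂ E]
    (b : HilbertBasis ι ℂ E) (i : ι) (r : ℝ) : (⟪b i, (r : ℂ) • b i⟫_ℂ).re = r := by
  rw [inner_smul_right, inner_self_eq_norm_sq_to_K, b.orthonormal.1 i]
  simp

variable {E : Type u} [NormedAddCommGroup E] [InnerProductSpace ℂ E] [CompleteSpace E]

theorem entropy_zero : entropy (0 : E →L[ℂ] E) = 0 := by
  simp [entropy, posTrace]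

theorem spectrum_mem_Icc {ρ : E →L[ℂ] E} (h0 : 0 ≤ ρ) (h1 : ρ ≤ 1) {x : ℝ}
    (hx : x ∈ spectrum ℝ ρ) : x ∈ Set.Icc 0 1 := by
  have hsa : IsSelfAdjoint ρ := ((ContinuousLinearMap.nonneg_iff_isPositive ρ).1 h0).isSelfAdjoint
  refine ⟨spectrum_nonneg_of_nonneg h0 hx, ?_⟩
  exact (CFC.le_one_iff (R := ℝ) ρ hsa).1 h1 x hx

theorem cfc_negMulLog_nonneg {ρ : E →L[ℂ] E} (h0 : 0 ≤ ρ) (h1 : ρ ≤ 1) :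
    0 ≤ cfc Real.negMulLog ρ :=
  cfc_nonneg fun _ hx =>
    Real.negMulLog_nonneg (spectrum_mem_Icc h0 h1 hx).1 (spectrum_mem_Icc h0 h1 hx).2

theorem entropy_eq_tsum {ρ : E →L[ℂ] E} (h0 : 0 ≤ ρ) (h1 : ρ ≤ 1) {ι : Type*}
    (b : HilbertBasis ι ℂ E) {l : ι → ℝ} (hb : ∀ i, ρ (b i) = (l i : ℂ) • b i) :
    entropy ρ = ∑' i, ENNReal.ofReal (Real.negMulLog (l i)) := by
  have hsa : IsSelfAdjoint ρ := ((ContinuousLinearMap.nonneg_iff_isPositive ρ).1 h0).isSelfAdjoint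
  rw [entropy, posTrace_eq_tsum (cfc_negMulLog_nonneg h0 h1) b]
  refine tsum_congr fun i => ?_
  rw [cfc_apply_of_apply_eq_smul hsa (hb i) Real.continuous_negMulLog.continuousOn,
    re_inner_smul_basis]

theorem posTrace_eq_tsum_eigenvalues {ρ : E →L[ℂ] E} (h0 : 0 ≤ ρ) {ι : Type*}
    (b : HilbertBasis ι ℂ E) {l : ι → ℝ} (hb : ∀ i, ρ (b i) = (l i : ℂ) • b i) :
    posTrace ρ = ∑' i, ENNReal.ofReal (l i) := by
  rw [posTrace_eq_tsum h0 b]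
  refine tsum_congr fun i => ?_
  rw [hb, re_inner_smul_basis]

theorem eigenvalue_mem_Icc {ρ : E →L[ℂ] E} (h0 : 0 ≤ ρ) (h1 : ρ ≤ 1) {ι : Type*}
    (b : HilbertBasis ι ℂ E) {l : ι → ℝ} (hb : ∀ i, ρ (b i) = (l i : ℂ) • b i) (i : ι) :
    l i ∈ Set.Icc 0 1 :=
  spectrum_mem_Icc h0 h1 (mem_spectrum_of_apply_eq_smul (b.orthonormal.ne_zero i) (hb i))

theorem isTraceClass_of_posTrace_eq_one {ρ : E →L[ℂ] E} (h0 : 0 ≤ ρ) (h1 : posTrace ρ = 1) :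
    IsTraceClass ρ :=
  isTraceClass_of_posTrace_lt_top h0 (by rw [h1]; exact ENNReal.one_lt_top)

theorem trace_of_posTrace_eq_one {ρ : E →L[ℂ] E} (h0 : 0 ≤ ρ) (h1 : posTrace ρ = 1) :
    trace ρ = 1 := by
  rw [(trace_eq_posTrace h0 (isTraceClass_of_posTrace_eq_one h0 h1)).2, h1]
  simp

theorem posTrace_eq_one_of_trace {ρ : E →L[ℂ] E} (h0 : 0 ≤ ρ) (htc : IsTraceClass ρ)
    (h1 : trace ρ = 1) : posTrace ρ = 1 := by
  obtain ⟨h2, h3⟩ := trace_eq_posTrace h0 htc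
  rw [h1] at h3
  rw [← ENNReal.ofReal_toReal h2.ne, ← ENNReal.ofReal_one]
  congr 1
  exact_mod_cast h3.symm

theorem posTrace_tensorCLM_eq_one {EA : Type u} {EB : Type v} [NormedAddCommGroup EA]
    [InnerProductSpace ℂ EA] [CompleteSpace EA] [NormedAddCommGroup EB] [InnerProductSpace ℂ EB]
    [CompleteSpace EB] {ρA : EA →L[ℂ] EA} {ρB : EB →L[ℂ] EB} (hA : 0 ≤ ρA) (hB : 0 ≤ ρB)
    (hA1 : posTrace ρA = 1) (hB1 : posTrace ρB = 1) : posTrace (tensorCLM ρA ρB) = 1 := by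
  have hA2 := isTraceClass_of_posTrace_eq_one hA hA1
  have hB2 := isTraceClass_of_posTrace_eq_one hB hB1
  refine posTrace_eq_one_of_trace (tensorCLM_nonneg hA hB) (hA2.tensorCLM hB2) ?_
  rw [trace_tensorCLM hA2 hB2, trace_of_posTrace_eq_one hA hA1, trace_of_posTrace_eq_one hB hB1,
    one_mul]

/-- The entropy of a product state is the sum of the entropies. -/
theorem entropy_tensorCLM {EA : Type u} {EB : Type v} [NormedAddCommGroup EA]
    [InnerProductSpace ℂ EA] [CompleteSpace EA] [NormedAddCommGroup EB] [InnerProductSpace ℂ EB]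
    [CompleteSpace EB] {ρA : EA →L[ℂ] EA} {ρB : EB →L[ℂ] EB} (hA : 0 ≤ ρA) (hB : 0 ≤ ρB)
    (hA1 : posTrace ρA = 1) (hB1 : posTrace ρB = 1) :
    entropy (tensorCLM ρA ρB) = entropy ρA + entropy ρB := by
  have hAle := le_one_of_posTrace_le_one hA hA1.le
  have hBle := le_one_of_posTrace_le_one hB hB1.le
  have hle := le_one_of_posTrace_le_one (tensorCLM_nonneg hA hB)
    (posTrace_tensorCLM_eq_one hA hB hA1 hB1).le
  obtain ⟨ι, a, p, ha⟩ := exists_hilbertBasis_eigenvectors hA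
    (isTraceClass_of_posTrace_eq_one hA hA1).isCompactOperator
  obtain ⟨κ, b, q, hb⟩ := exists_hilbertBasis_eigenvectors hB
    (isTraceClass_of_posTrace_eq_one hB hB1).isCompactOperator
  obtain ⟨c, hc⟩ := exists_tensor_hilbertBasis a b
  have hcσ : ∀ r, tensorCLM ρA ρB (c r) = ((p r.1 * q r.2 : ℝ) : ℂ) • c r := by
    intro r
    rw [hc, tensorCLM_pureTensor, ha, hb, pureTensor_smul_smul, Complex.ofReal_mul]
  have hp := eigenvalue_mem_Icc hA hAle a ha
  have hq := eigenvalue_mem_Icc hB hBle b hb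
  have hηp := fun i => Real.negMulLog_nonneg (hp i).1 (hp i).2
  have hηq := fun j => Real.negMulLog_nonneg (hq j).1 (hq j).2
  rw [entropy_eq_tsum (tensorCLM_nonneg hA hB) hle c hcσ, entropy_eq_tsum hA hAle a ha,
    entropy_eq_tsum hB hBle b hb]
  rw [posTrace_eq_tsum_eigenvalues hA a ha] at hA1
  rw [posTrace_eq_tsum_eigenvalues hB b hb] at hB1
  -- With η(x) = -x ln x, η(pq) = q η(p) + p η(q), and the eigenvalues of each factor sum to 1.
  calc ∑' r : ι × κ, ENNReal.ofReal (Real.negMulLog (p r.1 * q r.2))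
      = ∑' r : ι × κ, (ENNReal.ofReal (Real.negMulLog (p r.1)) * ENNReal.ofReal (q r.2) +
          ENNReal.ofReal (p r.1) * ENNReal.ofReal (Real.negMulLog (q r.2))) := by
        refine tsum_congr fun r => ?_
        rw [Real.negMulLog_mul, ENNReal.ofReal_add (mul_nonneg (hq _).1 (hηp _))
          (mul_nonneg (hp _).1 (hηq _)), ENNReal.ofReal_mul (hq _).1, ENNReal.ofReal_mul (hp _).1,
          mul_comm (ENNReal.ofReal (q r.2))]
    _ = _ := by
        rw [ENNReal.tsum_add]
        congr 1
        · rw [ENNReal.tsum_prod (f := fun i j =>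
            ENNReal.ofReal (Real.negMulLog (p i)) * ENNReal.ofReal (q j))]
          simp only [ENNReal.tsum_mul_left, hB1, mul_one]
        · rw [ENNReal.tsum_prod (f := fun i j =>
            ENNReal.ofReal (p i) * ENNReal.ofReal (Real.negMulLog (q j)))]
          simp only [ENNReal.tsum_mul_left, ENNReal.tsum_mul_right, hA1, one_mul]

/-- The right side is the tangent line at q of the concave function -x ln x. -/
theorem negMulLog_le {x q : ℝ} (hx : 0 ≤ x) (hq : 0 < q) :
    Real.negMulLog x ≤ (-Real.log q - 1) * x + q := by
  rcases hx.eq_or_lt with rfl | hx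
  · simpa using hq.le
  have h := Real.log_le_sub_one_of_pos (div_pos hq hx)
  rw [Real.log_div hq.ne' hx.ne'] at h
  have h2 := mul_le_mul_of_nonneg_left h hx.le
  have h3 : x * (q / x - 1) = q - x := by field_simp
  rw [h3] at h2
  rw [Real.negMulLog]
  linarith

/-- Klein's inequality, in the eigenbasis of the second state. -/
theorem entropy_le_tsum {σ : E →L[ℂ] E} (h0 : 0 ≤ σ) (h1 : posTrace σ = 1) {ι : Type*}
    (φ : HilbertBasis ι ℂ E) {q : ι → ℝ} (hq : ∀ k, 0 < q k)
    (hq1 : ∑' k, ENNReal.ofReal (q k) = 1) :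
    entropy σ ≤ ∑' k, ENNReal.ofReal (-Real.log (q k) * (⟪φ k, σ (φ k)⟫_ℂ).re) := by
  have hle := le_one_of_posTrace_le_one h0 h1.le
  have hsa : IsSelfAdjoint σ := ((ContinuousLinearMap.nonneg_iff_isPositive σ).1 h0).isSelfAdjoint
  have hqle : ∀ k, q k ≤ 1 := fun k => by
    have := ENNReal.le_tsum (f := fun k => ENNReal.ofReal (q k)) k
    rw [hq1] at this
    simpa using this
  have hη := cfc_negMulLog_nonneg h0 hle
  -- The tangent bound at q_k holds for σ by functional calculus and is evaluated at φ_k, so no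
  -- eigenbasis of σ is needed.
  have key : ∀ k, (⟪φ k, cfc Real.negMulLog σ (φ k)⟫_ℂ).re + (⟪φ k, σ (φ k)⟫_ℂ).re ≤
      -Real.log (q k) * (⟪φ k, σ (φ k)⟫_ℂ).re + q k := by
    intro k
    have h2 : cfc Real.negMulLog σ ≤ cfc (fun x : ℝ => (-Real.log (q k) - 1) * x + q k) σ :=
      cfc_mono (fun x hx => negMulLog_le (spectrum_mem_Icc h0 hle hx).1 (hq k))
        Real.continuous_negMulLog.continuousOn
    have h3 : cfc (fun x : ℝ => (-Real.log (q k) - 1) * x + q k) σ =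
        (-Real.log (q k) - 1) • σ + q k • 1 := by
      rw [cfc_add_const (q k) (fun x : ℝ => (-Real.log (q k) - 1) * x) σ,
        cfc_const_mul_id (-Real.log (q k) - 1) σ, Algebra.algebraMap_eq_smul_one]
    rw [h3] at h2
    have h4 := re_inner_nonneg (sub_nonneg.2 h2) (φ k)
    have h5 : (⟪φ k, ((-Real.log (q k) - 1) • σ + q k • (1 : E →L[ℂ] E)) (φ k)⟫_ℂ).re =
        (-Real.log (q k) - 1) * (⟪φ k, σ (φ k)⟫_ℂ).re + q k := by
      have e : ((-Real.log (q k) - 1) • σ + q k • (1 : E →L[ℂ] E)) (φ k) =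
          ((-Real.log (q k) - 1 : ℝ) : ℂ) • σ (φ k) + ((q k : ℝ) : ℂ) • φ k := by
        simp only [Complex.coe_smul]
        rfl
      rw [e, inner_add_right, Complex.add_re, re_inner_smul_basis, inner_smul_right,
        Complex.re_ofReal_mul]
    rw [sub_apply, inner_sub_right, Complex.sub_re, h5] at h4
    linarith
  -- The added 1 is tr σ on the left and ∑ q_k on the right. Adding keeps all terms nonnegative, so
  -- infinite sums need no subtraction.
  have hsum : entropy σ + 1 ≤
      ∑' k, ENNReal.ofReal (-Real.log (q k) * (⟪φ k, σ (φ k)⟫_ℂ).re) + 1 := by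
    calc entropy σ + 1
        = ∑' k, (ENNReal.ofReal (⟪φ k, cfc Real.negMulLog σ (φ k)⟫_ℂ).re +
            ENNReal.ofReal (⟪φ k, σ (φ k)⟫_ℂ).re) := by
          rw [ENNReal.tsum_add, ← posTrace_eq_tsum hη φ, ← posTrace_eq_tsum h0 φ, h1, entropy]
      _ ≤ ∑' k, (ENNReal.ofReal (-Real.log (q k) * (⟪φ k, σ (φ k)⟫_ℂ).re) +
            ENNReal.ofReal (q k)) := by
          refine ENNReal.tsum_le_tsum fun k => ?_
          have hlog : 0 ≤ -Real.log (q k) := neg_nonneg.2 (Real.log_nonpos (hq k).le (hqle k))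
          rw [← ENNReal.ofReal_add (re_inner_nonneg hη _) (re_inner_nonneg h0 _),
            ← ENNReal.ofReal_add (mul_nonneg hlog (re_inner_nonneg h0 _)) (hq k).le]
          exact ENNReal.ofReal_le_ofReal (key k)
      _ = _ := by rw [ENNReal.tsum_add, hq1]
  exact (ENNReal.add_le_add_iff_right ENNReal.one_ne_top).1 hsum

end Entropy

/-! ### Gibbs states and the variational principle. -/

section Gibbs

universe u

variable {E : Type u} [NormedAddCommGroup E] [InnerProductSpace ℂ E] [CompleteSpace E]

/-- The Gibbs state is a density matrix that is diagonal in an eigenbasis of `H`. -/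
theorem gibbsState_spec [Nontrivial E] {H : E →ₗ.[ℂ] E} (hH : IsSelfAdjoint H) {β : ℝ}
    (hβ : 0 < β) (hZ : partitionFunction β H < ⊤) :
    0 ≤ gibbsState β H ∧ posTrace (gibbsState β H) = 1 ∧
    ∃ (ι : Type u) (φ : HilbertBasis ι ℂ E) (ε : ι → ℝ) (c : ℝ),
      (∀ k, (φ k, (ε k : ℂ) • φ k) ∈ H.graph) ∧
      ∀ k, gibbsState β H (φ k) = (Real.exp (-(β * ε k + c)) : ℂ) • φ k := by
  obtain ⟨ι, φ, ε, hφ, hT⟩ := exists_hilbertBasis_energy hH hβ hZ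
  have hT0 := expNeg_nonneg β H
  have hZ1 : partitionFunction β H = ∑' k, ENNReal.ofReal (Real.exp (-β * ε k)) := by
    rw [(partitionFunction_eq_posTrace hZ).2]
    exact posTrace_eq_tsum_eigenvalues hT0 φ hT
  -- Nontriviality of the space excludes an empty basis, for which the partition function would be
  -- 0.
  have hne : Nonempty ι := by
    by_contra hι
    rw [not_nonempty_iff] at hι
    obtain ⟨x, hx⟩ := exists_ne (0 : E)
    exact hx (eq_zero_of_inner_hilbertBasis φ fun i => hι.elim i)
  have hZ0 : partitionFunction β H ≠ 0 := by
    rw [hZ1, Ne, ENNReal.tsum_eq_zero]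
    intro h
    have := h hne.some
    rw [ENNReal.ofReal_eq_zero] at this
    exact absurd this (not_le.2 (Real.exp_pos _))
  have hZpos : 0 < (partitionFunction β H).toReal := ENNReal.toReal_pos hZ0 hZ.ne
  set Z := (partitionFunction β H).toReal with hZdef
  have hρ : ∀ k, gibbsState β H (φ k) = (Real.exp (-(β * ε k + Real.log Z)) : ℂ) • φ k := by
    intro k
    have e : gibbsState β H (φ k) = ((Z⁻¹ : ℝ) : ℂ) • expNeg β H (φ k) := by
      rw [Complex.coe_smul]
      rfl
    rw [e, hT, smul_smul, ← Complex.ofReal_mul]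
    congr 2
    rw [neg_add, Real.exp_add, Real.exp_neg (Real.log Z), Real.exp_log hZpos, mul_comm, neg_mul]
  have h0 : 0 ≤ gibbsState β H := smul_nonneg (inv_nonneg.2 hZpos.le) hT0
  -- The normalization is absorbed in the exponent: c = ln Z.
  refine ⟨h0, ?_, ι, φ, ε, Real.log Z, hφ, hρ⟩
  rw [posTrace_eq_tsum_eigenvalues h0 φ hρ]
  have e : ∀ k, ENNReal.ofReal (Real.exp (-(β * ε k + Real.log Z))) =
      ENNReal.ofReal (Real.exp (-β * ε k)) * ENNReal.ofReal Z⁻¹ := by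
    intro k
    rw [← ENNReal.ofReal_mul (Real.exp_pos _).le]
    congr 1
    rw [neg_add, Real.exp_add, Real.exp_neg (Real.log Z), Real.exp_log hZpos, neg_mul]
  simp only [e]
  rw [ENNReal.tsum_mul_right, ← hZ1, ENNReal.ofReal_inv_of_pos hZpos, hZdef,
    ENNReal.ofReal_toReal hZ.ne, ENNReal.mul_inv_cancel hZ0 hZ.ne]

/-- The energy expectation of a state, computed in an eigenbasis of the Hamiltonian. -/
theorem hasSum_energy {ι : Type*} (φ : HilbertBasis ι ℂ E) {ε : ι → ℝ} (β c : ℝ)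
    {σ K : E →L[ℂ] E} (h0 : 0 ≤ σ) (h1 : posTrace σ = 1) (hK : IsTraceClass K)
    (hKσ : ∀ k, ⟪φ k, K (φ k)⟫_ℂ = (ε k : ℂ) * ⟪φ k, σ (φ k)⟫_ℂ) :
    (trace K).im = 0 ∧
    HasSum (fun k => (β * ε k + c) * (⟪φ k, σ (φ k)⟫_ℂ).re) (β * (trace K).re + c) := by
  have h2 := hK.hasSum_trace φ
  simp only [hKσ] at h2
  constructor
  · refine (Complex.hasSum_im h2).unique ?_
    simp [im_inner_eq_zero h0]
  · have h3 := Complex.hasSum_re h2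
    have h4 := Complex.hasSum_re ((isTraceClass_of_posTrace_eq_one h0 h1).hasSum_trace φ)
    rw [trace_of_posTrace_eq_one h0 h1, Complex.one_re] at h4
    have h5 := (h3.mul_left β).add (h4.mul_left c)
    rw [mul_one] at h5
    refine h5.congr_fun fun k => ?_
    rw [Complex.re_ofReal_mul]
    ring

/-- The Gibbs variational principle: `S(σ) ≤ β tr (H σ) + ln Z` for every state `σ`, with equality
for the Gibbs state. -/
theorem gibbs_variational {ι : Type*} (φ : HilbertBasis ι ℂ E) {ε : ι → ℝ} {β c : ℝ}
    {ρ σ K K' : E →L[ℂ] E} (hρ0 : 0 ≤ ρ) (hρ1 : posTrace ρ = 1)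
    (hρ : ∀ k, ρ (φ k) = (Real.exp (-(β * ε k + c)) : ℂ) • φ k)
    (hK : IsTraceClass K) (hKρ : ∀ k, ⟪φ k, K (φ k)⟫_ℂ = (ε k : ℂ) * ⟪φ k, ρ (φ k)⟫_ℂ)
    (hσ0 : 0 ≤ σ) (hσ1 : posTrace σ = 1)
    (hK' : IsTraceClass K') (hKσ : ∀ k, ⟪φ k, K' (φ k)⟫_ℂ = (ε k : ℂ) * ⟪φ k, σ (φ k)⟫_ℂ) :
    entropy ρ < ⊤ ∧ entropy σ < ⊤ ∧ (trace K).im = 0 ∧ (trace K').im = 0 ∧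
      (entropy σ).toReal - (entropy ρ).toReal ≤ β * ((trace K').re - (trace K).re) := by
  have hρle := le_one_of_posTrace_le_one hρ0 hρ1.le
  obtain ⟨him, hsum⟩ := hasSum_energy φ β c hρ0 hρ1 hK hKρ
  obtain ⟨him', hsum'⟩ := hasSum_energy φ β c hσ0 hσ1 hK' hKσ
  -- Eigenvalues of a state are at most 1, so the shifted energies are nonnegative and real sums
  -- transfer to [0, ∞].
  have hnn : ∀ k, 0 ≤ β * ε k + c := by
    intro k
    have := (eigenvalue_mem_Icc hρ0 hρle φ hρ k).2
    rw [Real.exp_le_one_iff] at this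
    linarith
  have hterm : ∀ {τ : E →L[ℂ] E}, 0 ≤ τ → ∀ k, 0 ≤ (β * ε k + c) * (⟪φ k, τ (φ k)⟫_ℂ).re :=
    fun hτ k => mul_nonneg (hnn k) (re_inner_nonneg hτ _)
  have hSρ : entropy ρ = ENNReal.ofReal (β * (trace K).re + c) := by
    rw [entropy_eq_tsum hρ0 hρle φ hρ, ← hsum.tsum_eq,
      ENNReal.ofReal_tsum_of_nonneg (hterm hρ0) hsum.summable]
    refine tsum_congr fun k => ?_
    rw [hρ, re_inner_smul_basis, Real.negMulLog, Real.log_exp]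
    congr 1
    ring
  have hSσ : entropy σ ≤ ENNReal.ofReal (β * (trace K').re + c) := by
    refine (entropy_le_tsum hσ0 hσ1 φ (q := fun k => Real.exp (-(β * ε k + c)))
      (fun k => Real.exp_pos _) ?_).trans_eq ?_
    · rw [← posTrace_eq_tsum_eigenvalues hρ0 φ hρ, hρ1]
    · rw [← hsum'.tsum_eq, ENNReal.ofReal_tsum_of_nonneg (hterm hσ0) hsum'.summable]
      simp only [Real.log_exp, neg_neg]
  refine ⟨hSρ ▸ ENNReal.ofReal_lt_top, hSσ.trans_lt ENNReal.ofReal_lt_top, him, him', ?_⟩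
  have h1 := ENNReal.toReal_mono ENNReal.ofReal_ne_top hSσ
  rw [ENNReal.toReal_ofReal (hsum'.nonneg (hterm hσ0))] at h1
  rw [hSρ, ENNReal.toReal_ofReal (hsum.nonneg (hterm hρ0))]
  linarith

end Gibbs

/-! ### Weak products of unbounded and bounded operators. -/

section WeakProduct

variable {E : Type*} [NormedAddCommGroup E] [InnerProductSpace ℂ E]

/-- `K = T* ρ` in the weak sense: `⟪T z, ρ x⟫ = ⟪z, K x⟫` for all `z` in the domain of `T`. -/
def IsWeakProduct (T : E →ₗ.[ℂ] E) (ρ K : E →L[ℂ] E) : Prop :=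
  ∀ p ∈ T.graph, ∀ x, ⟪p.2, ρ x⟫_ℂ = ⟪p.1, K x⟫_ℂ

/-- For a non-closable T, `T.closure` is T by convention, and the inclusion still holds. Thus
closability never has to be established. -/
theorem graph_closure_subset (T : E →ₗ.[ℂ] E) :
    (T.closure.graph : Set (E × E)) ⊆ closure (T.graph : Set (E × E)) := by
  by_cases h : T.IsClosable
  · rw [← h.graph_closure_eq_closure_graph]
    exact subset_rfl
  · rw [LinearPMap.closure_def' h]
    exact subset_closure

theorem mem_graph_closure {T : E →ₗ.[ℂ] E} {p : E × E} (hp : p ∈ T.graph) :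
    p ∈ T.closure.graph :=
  LinearPMap.le_graph_of_le T.le_closure hp

theorem IsWeakProduct.closure {T : E →ₗ.[ℂ] E} {ρ K : E →L[ℂ] E} (h : IsWeakProduct T ρ K) :
    IsWeakProduct T.closure ρ K := by
  intro p hp x
  have hcl : IsClosed {p : E × E | ⟪p.2, ρ x⟫_ℂ = ⟪p.1, K x⟫_ℂ} :=
    isClosed_eq (by fun_prop) (by fun_prop)
  exact closure_minimal (fun p hp => h p hp x) hcl (graph_closure_subset T hp)

/-- Symmetry of T on its graph extends by continuity to one argument in the closure, where the range
of ρ lies. -/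
theorem IsProduct.isWeakProduct {T : E →ₗ.[ℂ] E} {ρ K : E →L[ℂ] E}
    (hT : ∀ p ∈ T.graph, ∀ q ∈ T.graph, ⟪p.2, q.1⟫_ℂ = ⟪p.1, q.2⟫_ℂ)
    (h : IsProduct T.closure ρ K) : IsWeakProduct T ρ K := by
  intro p hp x
  have hcl : IsClosed {q : E × E | ⟪p.2, q.1⟫_ℂ = ⟪p.1, q.2⟫_ℂ} :=
    isClosed_eq (by fun_prop) (by fun_prop)
  exact closure_minimal (hT p hp) hcl (graph_closure_subset T (h x))

theorem IsProduct.sub {T : E →ₗ.[ℂ] E} {ρ ρ' K K' : E →L[ℂ] E} (h : IsProduct T ρ K)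
    (h' : IsProduct T ρ' K') : IsProduct T (ρ - ρ') (K - K') :=
  fun x => T.graph.sub_mem (h x) (h' x)

theorem IsProduct.productOp_eq {T : E →ₗ.[ℂ] E} {ρ K : E →L[ℂ] E} (h : IsProduct T ρ K) :
    productOp T ρ = K := by
  have hex : ∃ K : E →L[ℂ] E, IsProduct T ρ K := ⟨K, h⟩
  rw [productOp, dif_pos hex]
  ext x
  exact T.mem_graph_snd_inj (hex.choose_spec x) (h x) rfl

theorem add_graph_decompose {S T : E →ₗ.[ℂ] E} {p : E × E} (hp : p ∈ (S + T).graph) :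
    ∃ s t, (p.1, s) ∈ S.graph ∧ (p.1, t) ∈ T.graph ∧ p.2 = s + t := by
  obtain ⟨x, hx1, hx2⟩ := (LinearPMap.mem_graph_iff _).1 hp
  rw [← hx1, ← hx2]
  exact ⟨S ⟨x, x.2.1⟩, T ⟨x, x.2.2⟩, S.mem_graph ⟨x, x.2.1⟩, T.mem_graph ⟨x, x.2.2⟩,
    LinearPMap.add_apply _ _ _⟩

theorem add_mem_graph {S T : E →ₗ.[ℂ] E} {x s t : E} (hs : (x, s) ∈ S.graph)
    (ht : (x, t) ∈ T.graph) : (x, s + t) ∈ (S + T).graph := by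
  obtain ⟨⟨y, hy⟩, rfl, rfl⟩ := (LinearPMap.mem_graph_iff _).1 hs
  obtain ⟨⟨z, hz⟩, hz1, rfl⟩ := (LinearPMap.mem_graph_iff _).1 ht
  obtain rfl : z = y := hz1
  exact (LinearPMap.mem_graph_iff _).2 ⟨⟨z, hy, hz⟩, rfl, LinearPMap.add_apply _ _ _⟩

theorem IsWeakProduct.add {S T : E →ₗ.[ℂ] E} {ρ K L : E →L[ℂ] E} (hS : IsWeakProduct S ρ K)
    (hT : IsWeakProduct T ρ L) : IsWeakProduct (S + T) ρ (K + L) := by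
  intro p hp x
  obtain ⟨s, t, hs, ht, hst⟩ := add_graph_decompose hp
  rw [hst, inner_add_left, hS _ hs, hT _ ht, add_apply, inner_add_right]

/-- The eigenvector takes the unbounded operator, so the range of ρ need not lie in its domain. This
feeds `gibbs_variational`. -/
theorem IsWeakProduct.inner_eigenvector {T : E →ₗ.[ℂ] E} {ρ K : E →L[ℂ] E}
    (h : IsWeakProduct T ρ K) {φ : E} {ε : ℝ} (hφ : (φ, (ε : ℂ) • φ) ∈ T.graph) :
    ⟪φ, K φ⟫_ℂ = (ε : ℂ) * ⟪φ, ρ φ⟫_ℂ := by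
  rw [← h _ hφ φ, inner_smul_left, Complex.conj_ofReal]

end WeakProduct

/-! ### Local Hamiltonians, the interaction and their weak products. -/

section TensorPMap

variable {EA EB : Type*} [NormedAddCommGroup EA] [InnerProductSpace ℂ EA]
  [NormedAddCommGroup EB] [InnerProductSpace ℂ EB]

theorem tensorPMap_mem_graph_iff {S : EA →ₗ.[ℂ] EA} {T : EB →ₗ.[ℂ] EB}
    {p : HilbertTensor EA EB × HilbertTensor EA EB} :
    p ∈ (tensorPMap S T).graph ↔ ∃ t : S.domain ⊗[ℂ] T.domain,
      p = (domainEmbedding S.domain T.domain t,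
        ((TensorProduct.map S.toFun T.toFun t : EA ⊗[ℂ] EB) : HilbertTensor EA EB)) := by
  set e := LinearEquiv.ofInjective (domainEmbedding S.domain T.domain)
      (domainEmbedding_injective S.domain T.domain)
  have happ : ∀ y : (tensorPMap S T).domain, tensorPMap S T y =
      ((TensorProduct.map S.toFun T.toFun (e.symm y) : EA ⊗[ℂ] EB) : HilbertTensor EA EB) :=
    fun y => rfl
  rw [LinearPMap.mem_graph_iff]
  constructor
  · rintro ⟨y, hy1, hy2⟩
    refine ⟨e.symm y, Prod.ext ?_ ?_⟩
    · rw [← hy1]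
      exact (congrArg Subtype.val (e.apply_symm_apply y)).symm
    · rw [← hy2, happ]
  · rintro ⟨t, rfl⟩
    refine ⟨e t, rfl, (happ (e t)).trans ?_⟩
    exact congrArg (fun s => ((TensorProduct.map S.toFun T.toFun s : EA ⊗[ℂ] EB) :
      HilbertTensor EA EB)) (e.symm_apply_apply t)

theorem pureTensor_mem_graph {S : EA →ₗ.[ℂ] EA} {T : EB →ₗ.[ℂ] EB} (a : S.domain)
    (b : T.domain) :
    (pureTensor (a : EA) (b : EB), pureTensor (S a) (T b)) ∈ (tensorPMap S T).graph :=
  tensorPMap_mem_graph_iff.2 ⟨a ⊗ₜ b, rfl⟩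

theorem tensorPMap_graph_induction {S : EA →ₗ.[ℂ] EA} {T : EB →ₗ.[ℂ] EB}
    {P : HilbertTensor EA EB × HilbertTensor EA EB → Prop} (hzero : P 0)
    (htmul : ∀ (a : S.domain) (b : T.domain),
      P (pureTensor (a : EA) (b : EB), pureTensor (S a) (T b)))
    (hadd : ∀ p q, P p → P q → P (p + q)) {p : HilbertTensor EA EB × HilbertTensor EA EB}
    (hp : p ∈ (tensorPMap S T).graph) : P p := by
  obtain ⟨t, rfl⟩ := tensorPMap_mem_graph_iff.1 hp
  clear hp
  induction t with
  | zero =>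
    rw [map_zero, map_zero, UniformSpace.Completion.coe_zero]
    exact hzero
  | tmul a b => exact htmul a b
  | add s t hs ht =>
    rw [map_add, map_add, UniformSpace.Completion.coe_add]
    exact hadd _ _ hs ht

theorem tensorPMap_graph_symm {S : EA →ₗ.[ℂ] EA} {T : EB →ₗ.[ℂ] EB} (hS : IsSymmetric S)
    (hT : IsSymmetric T) : ∀ p ∈ (tensorPMap S T).graph, ∀ q ∈ (tensorPMap S T).graph,
      ⟪p.2, q.1⟫_ℂ = ⟪p.1, q.2⟫_ℂ := by
  intro p hp q hq
  refine tensorPMap_graph_induction (P := fun p => ⟪p.2, q.1⟫_ℂ = ⟪p.1, q.2⟫_ℂ) (by simp)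
    (fun a b => ?_) (fun p p' h h' => ?_) hp
  · refine tensorPMap_graph_induction
      (P := fun q => ⟪pureTensor (S a) (T b), q.1⟫_ℂ = ⟪pureTensor (a : EA) (b : EB), q.2⟫_ℂ)
      (by simp) (fun a' b' => ?_) (fun q q' h h' => ?_) hq
    · simp only [inner_pureTensor, hS a a', hT b b']
    · simp only [Prod.fst_add, Prod.snd_add, inner_add_right, h, h']
  · simp only [Prod.fst_add, Prod.snd_add, inner_add_left, h, h']

theorem IsWeakProduct.of_pureTensor {S : EA →ₗ.[ℂ] EA} {T : EB →ₗ.[ℂ] EB}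
    {ρ K : HilbertTensor EA EB →L[ℂ] HilbertTensor EA EB}
    (h : ∀ (a : S.domain) (b : T.domain) u v,
      ⟪pureTensor (S a) (T b), ρ (pureTensor u v)⟫_ℂ =
        ⟪pureTensor (a : EA) (b : EB), K (pureTensor u v)⟫_ℂ) :
    IsWeakProduct (tensorPMap S T) ρ K := by
  intro p hp
  refine tensorPMap_graph_induction (P := fun p => ∀ x, ⟪p.2, ρ x⟫_ℂ = ⟪p.1, K x⟫_ℂ) (by simp)
    (fun a b x => ?_) (fun p q hp hq x => ?_) hp
  · have := clm_ext_pureTensor (S := innerSL ℂ (pureTensor (S a) (T b)) ∘L ρ)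
      (T := innerSL ℂ (pureTensor (a : EA) (b : EB)) ∘L K) (h a b)
    exact congrArg (fun L => L x) this
  · simp only [Prod.fst_add, Prod.snd_add, inner_add_left, hp, hq]

theorem tensorDomain_mono {p p' : Submodule ℂ EA} {q q' : Submodule ℂ EB} (hp : p ≤ p')
    (hq : q ≤ q') : tensorDomain p q ≤ tensorDomain p' q' := by
  rintro _ ⟨t, rfl⟩
  induction t with
  | zero => rw [map_zero]; exact Submodule.zero_mem _
  | tmul a b => exact ⟨(⟨a, hp a.2⟩ : p') ⊗ₜ (⟨b, hq b.2⟩ : q'), rfl⟩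
  | add s t hs ht => rw [map_add]; exact Submodule.add_mem _ hs ht

theorem isSymmetric_id (E : Type*) [NormedAddCommGroup E] [InnerProductSpace ℂ E] :
    IsSymmetric ((LinearMap.id : E →ₗ[ℂ] E).toPMap ⊤) := fun _ _ => rfl

theorem id_toPMap_apply {E : Type*} [NormedAddCommGroup E] [InnerProductSpace ℂ E]
    (x : ((LinearMap.id : E →ₗ[ℂ] E).toPMap ⊤).domain) :
    (LinearMap.id : E →ₗ[ℂ] E).toPMap ⊤ x = (x : E) := rfl

/-- The interaction term is symmetric, as the difference of symmetric operators. -/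
theorem interaction_graph_symm {HA : EA →ₗ.[ℂ] EA} {HB : EB →ₗ.[ℂ] EB}
    {Hbd : HilbertTensor EA EB →ₗ.[ℂ] HilbertTensor EA EB}
    (hA : IsSymmetric HA) (hB : IsSymmetric HB)
    (hdom : Hbd.domain = tensorDomain HA.domain HB.domain)
    (hesa : IsEssentiallySelfAdjoint (tensorOne HA + oneTensor HB + Hbd)) :
    ∀ p ∈ Hbd.graph, ∀ q ∈ Hbd.graph, ⟪p.2, q.1⟫_ℂ = ⟪p.1, q.2⟫_ℂ := by
  have hext : ∀ p ∈ Hbd.graph, ∃ s t, (p.1, s) ∈ (tensorOne (EB := EB) HA).graph ∧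
      (p.1, t) ∈ (oneTensor (EA := EA) HB).graph ∧
      (p.1, s + t + p.2) ∈ (tensorOne HA + oneTensor HB + Hbd).closure.graph := by
    intro p hp
    have h1 : p.1 ∈ tensorDomain HA.domain HB.domain :=
      hdom ▸ LinearPMap.mem_domain_of_mem_graph hp
    have hs := (tensorOne (EB := EB) HA).mem_graph ⟨p.1, tensorDomain_mono le_rfl le_top h1⟩
    have ht := (oneTensor (EA := EA) HB).mem_graph ⟨p.1, tensorDomain_mono le_top le_rfl h1⟩
    exact ⟨_, _, hs, ht, mem_graph_closure (add_mem_graph (add_mem_graph hs ht) hp)⟩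
  intro p hp q hq
  obtain ⟨s, t, hs, ht, hst⟩ := hext p hp
  obtain ⟨s', t', hs', ht', hst'⟩ := hext q hq
  -- The self-adjoint closure is symmetric; subtracting the symmetry of both local terms leaves that
  -- of the interaction.
  have h1 := (mem_graph_iff_of_isSelfAdjoint hesa).1 hst' _ hst
  have h2 := tensorPMap_graph_symm hA (isSymmetric_id EB) _ hs _ hs'
  have h3 := tensorPMap_graph_symm (isSymmetric_id EA) hB _ ht _ ht'
  simp only [inner_add_left, inner_add_right] at h1 h2 h3
  rw [h2, h3] at h1
  exact add_left_cancel h1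

variable [CompleteSpace EA] [CompleteSpace EB]

/-- `tr_B ((S ⊗ 1) ρ) = S ρ_A`, weakly, and hence `(S ⊗ 1) (ρ_A ⊗ τ) = tr_B ((S ⊗ 1) ρ) ⊗ τ`. -/
theorem IsWeakProduct.tensorOne_traceOutRight {S : EA →ₗ.[ℂ] EA}
    {ρ K : HilbertTensor EA EB →L[ℂ] HilbertTensor EA EB} (hρ : IsTraceClass ρ)
    (hK : IsTraceClass K) (h : IsWeakProduct (tensorOne S) ρ K) (τ : EB →L[ℂ] EB) :
    IsWeakProduct (tensorOne S) (tensorCLM (traceOutRight ρ) τ)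
      (tensorCLM (traceOutRight K) τ) := by
  have key : ∀ (a : S.domain) u,
      ⟪S a, traceOutRight ρ u⟫_ℂ = ⟪(a : EA), traceOutRight K u⟫_ℂ := by
    intro a u
    have h1 := inner_partialTrace (hρ.partialTrace hasSum_inner_adjoint_tmulRight).1 (S a) u
    have h2 := inner_partialTrace (hK.partialTrace hasSum_inner_adjoint_tmulRight).1 (a : EA) u
    refine h1.unique (h2.congr_fun fun j => ?_)
    -- The weak identity at a ⊗ e_j and u ⊗ e_j, to be summed over j.
    exact h _ (pureTensor_mem_graph a ⟨basis EB j, Submodule.mem_top⟩) _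
  refine IsWeakProduct.of_pureTensor fun a b u v => ?_
  simp only [tensorCLM_pureTensor, inner_pureTensor, key, id_toPMap_apply]

theorem IsWeakProduct.oneTensor_traceOutLeft {T : EB →ₗ.[ℂ] EB}
    {ρ K : HilbertTensor EA EB →L[ℂ] HilbertTensor EA EB} (hρ : IsTraceClass ρ)
    (hK : IsTraceClass K) (h : IsWeakProduct (oneTensor T) ρ K) (τ : EA →L[ℂ] EA) :
    IsWeakProduct (oneTensor T) (tensorCLM τ (traceOutLeft ρ))
      (tensorCLM τ (traceOutLeft K)) := by
  have key : ∀ (b : T.domain) v,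
      ⟪T b, traceOutLeft ρ v⟫_ℂ = ⟪(b : EB), traceOutLeft K v⟫_ℂ := by
    intro b v
    have h1 := inner_partialTrace (hρ.partialTrace hasSum_inner_adjoint_tmulLeft).1 (T b) v
    have h2 := inner_partialTrace (hK.partialTrace hasSum_inner_adjoint_tmulLeft).1 (b : EB) v
    refine h1.unique (h2.congr_fun fun i => ?_)
    exact h _ (pureTensor_mem_graph ⟨basis EA i, Submodule.mem_top⟩ b) _
  refine IsWeakProduct.of_pureTensor fun a b u v => ?_
  simp only [tensorCLM_pureTensor, inner_pureTensor, key, id_toPMap_apply]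

end TensorPMap

end QuantumThermal

end

/-! ### The mutual information bound. -/

open QuantumThermal in
theorem mainTheorem3 {EA EB : Type*}
    [NormedAddCommGroup EA] [InnerProductSpace ℂ EA] [CompleteSpace EA]
    [NormedAddCommGroup EB] [InnerProductSpace ℂ EB] [CompleteSpace EB]
    (HA : EA →ₗ.[ℂ] EA) (HB : EB →ₗ.[ℂ] EB)
    (Hbd HAB : HilbertTensor EA EB →ₗ.[ℂ] HilbertTensor EA EB)
    (hA_dense : Dense (HA.domain : Set EA)) (hA_symm : IsSymmetric HA)
    (hB_dense : Dense (HB.domain : Set EB)) (hB_symm : IsSymmetric HB)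
    (hbd_dom : Hbd.domain = tensorDomain HA.domain HB.domain)
    (hHAB : HAB = tensorOne HA + oneTensor HB + Hbd)
    (hHAB_esa : IsEssentiallySelfAdjoint HAB)
    (β : ℝ) (hβ : 0 < β)
    (hZ : partitionFunction β HAB.closure < ⊤)
    (ρAB : HilbertTensor EA EB →L[ℂ] HilbertTensor EA EB)
    (hρAB : ρAB = gibbsState β HAB.closure)
    (ρA : EA →L[ℂ] EA) (hρA : ρA = traceOutRight ρAB)
    (ρB : EB →L[ℂ] EB) (hρB : ρB = traceOutLeft ρAB)
    (hA_tr : HasTrace (tensorOne (EB := EB) HA).closure ρAB)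
    (hB_tr : HasTrace (oneTensor (EA := EA) HB).closure ρAB)
    (hbd_tr : HasTrace Hbd.closure ρAB)
    (hbd_tr' : HasTrace Hbd.closure (tensorCLM ρA ρB)) :
    entropy ρAB < ⊤ ∧ entropy ρA < ⊤ ∧ entropy ρB < ⊤ ∧
    HasTrace Hbd.closure (tensorCLM ρA ρB - ρAB) ∧
    (trace (productOp Hbd.closure (tensorCLM ρA ρB - ρAB))).im = 0 ∧
    mutualInformation ρAB ≤
      β * (trace (productOp Hbd.closure (tensorCLM ρA ρB - ρAB))).re := by
  subst hρA hρB hHAB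
  -- On the zero space the Gibbs state is 0 and has no unit trace; there all entropies and traces
  -- vanish.
  rcases subsingleton_or_nontrivial (HilbertTensor EA EB) with hE | hE
  · have h0 : ρAB = 0 := Subsingleton.elim _ _
    have hA0 : traceOutRight ρAB = 0 := by simp [h0, traceOutRight]
    have hB0 : traceOutLeft ρAB = 0 := by simp [h0, traceOutLeft]
    have hprod : productOp Hbd.closure
        (tensorCLM (traceOutRight ρAB) (traceOutLeft ρAB) - ρAB) = 0 := Subsingleton.elim _ _
    have htr : trace (0 : HilbertTensor EA EB →L[ℂ] HilbertTensor EA EB) = 0 := by simp [trace]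
    rw [hprod, htr, mutualInformation, hA0, hB0]
    have hσ : tensorCLM 0 0 - ρAB = ρAB := Subsingleton.elim _ _
    rw [hσ]
    refine ⟨?_, ?_, ?_, hbd_tr, by simp, ?_⟩ <;> simp [h0, entropy_zero]
  subst hρAB
  obtain ⟨hρ0, hρ1, ι, φ, ε, c, hφ, hρφ⟩ := gibbsState_spec hHAB_esa hβ hZ
  set ρ := gibbsState β (tensorOne HA + oneTensor HB + Hbd).closure
  have hρtc := isTraceClass_of_posTrace_eq_one hρ0 hρ1
  have hρtr := trace_of_posTrace_eq_one hρ0 hρ1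
  obtain ⟨hAs, hAtc, hAtr⟩ := hρtc.partialTrace hasSum_inner_adjoint_tmulRight
  obtain ⟨hBs, hBtc, hBtr⟩ := hρtc.partialTrace hasSum_inner_adjoint_tmulLeft
  have hA0 : 0 ≤ traceOutRight ρ := partialTrace_nonneg hρ0 hAs
  have hB0 : 0 ≤ traceOutLeft ρ := partialTrace_nonneg hρ0 hBs
  change IsTraceClass (traceOutRight ρ) at hAtc
  change IsTraceClass (traceOutLeft ρ) at hBtc
  change trace (traceOutRight ρ) = trace ρ at hAtr
  change trace (traceOutLeft ρ) = trace ρ at hBtr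
  rw [hρtr] at hAtr hBtr
  have hA1 := posTrace_eq_one_of_trace hA0 hAtc hAtr
  have hB1 := posTrace_eq_one_of_trace hB0 hBtc hBtr
  obtain ⟨KA, hKA, hKAtc⟩ := hA_tr
  obtain ⟨KB, hKB, hKBtc⟩ := hB_tr
  obtain ⟨Kbd, hKbd, hKbdtc⟩ := hbd_tr
  obtain ⟨Kbd', hKbd', hKbdtc'⟩ := hbd_tr'
  have hsymm := interaction_graph_symm hA_symm hB_symm hbd_dom hHAB_esa
  have hwA := IsProduct.isWeakProduct (tensorPMap_graph_symm hA_symm (isSymmetric_id EB)) hKA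
  have hwB := IsProduct.isWeakProduct (tensorPMap_graph_symm (isSymmetric_id EA) hB_symm) hKB
  have hw := ((hwA.add hwB).add (hKbd.isWeakProduct hsymm)).closure
  -- Only the interaction trace in the product state is assumed to exist; both local products are
  -- built from those with ρ.
  have hw' := (((hwA.tensorOne_traceOutRight hρtc hKAtc (traceOutLeft ρ)).add
    (hwB.oneTensor_traceOutLeft hρtc hKBtc (traceOutRight ρ))).add
    (hKbd'.isWeakProduct hsymm)).closure
  obtain ⟨-, hKAtc', hKAtr⟩ := hKAtc.partialTrace hasSum_inner_adjoint_tmulRight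
  obtain ⟨-, hKBtc', hKBtr⟩ := hKBtc.partialTrace hasSum_inner_adjoint_tmulLeft
  change IsTraceClass (traceOutRight KA) at hKAtc'
  change IsTraceClass (traceOutLeft KB) at hKBtc'
  change trace (traceOutRight KA) = trace KA at hKAtr
  change trace (traceOutLeft KB) = trace KB at hKBtr
  have htr : trace (KA + KB + Kbd) = trace KA + trace KB + trace Kbd := by
    rw [trace_add (hKAtc.add hKBtc) hKbdtc, trace_add hKAtc hKBtc]
  -- Partial traces preserve the trace and the marginals have trace 1, so the local energies equal
  -- those in ρ.
  have htr' : trace (tensorCLM (traceOutRight KA) (traceOutLeft ρ) +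
      tensorCLM (traceOutRight ρ) (traceOutLeft KB) + Kbd') =
      trace KA + trace KB + trace Kbd' := by
    rw [trace_add ((hKAtc'.tensorCLM hBtc).add (hAtc.tensorCLM hKBtc')) hKbdtc',
      trace_add (hKAtc'.tensorCLM hBtc) (hAtc.tensorCLM hKBtc'), trace_tensorCLM hKAtc' hBtc,
      trace_tensorCLM hAtc hKBtc', hKAtr, hKBtr, hAtr, hBtr, mul_one, one_mul]
  obtain ⟨hSρ, hSσ, him, him', hle⟩ := gibbs_variational φ hρ0 hρ1 hρφ
    ((hKAtc.add hKBtc).add hKbdtc) (fun k => hw.inner_eigenvector (hφ k))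
    (tensorCLM_nonneg hA0 hB0) (posTrace_tensorCLM_eq_one hA0 hB0 hA1 hB1)
    (((hKAtc'.tensorCLM hBtc).add (hAtc.tensorCLM hKBtc')).add hKbdtc')
    (fun k => hw'.inner_eigenvector (hφ k))
  have hent := entropy_tensorCLM hA0 hB0 hA1 hB1
  rw [hent] at hSσ hle
  obtain ⟨hSA, hSB⟩ := ENNReal.add_lt_top.1 hSσ
  have hprod := hKbd'.sub hKbd
  have htrsub : trace (productOp Hbd.closure
      (tensorCLM (traceOutRight ρ) (traceOutLeft ρ) - ρ)) = trace Kbd' - trace Kbd := by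
    rw [hprod.productOp_eq, trace_sub hKbdtc' hKbdtc]
  rw [htr, Complex.add_im, Complex.add_im] at him
  rw [htr', Complex.add_im, Complex.add_im] at him'
  rw [htr, htr', ENNReal.toReal_add hSA.ne hSB.ne] at hle
  simp only [Complex.add_re] at hle
  refine ⟨hSρ, hSA, hSB, ⟨_, hprod, hKbdtc'.sub hKbdtc⟩, ?_, ?_⟩
  · rw [htrsub, Complex.sub_im]
    linarith
  · rw [htrsub, Complex.sub_re, mutualInformation]
    linarith
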